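/- Let $(\Omega,\mathcal F,\mathbb P)$ be a probability space with an ergodic group $(\tau_k)_{k\in\mathbb Z}$ of measure preserving transformations: $\tau_0=\mathrm{id}$, $\tau_{k+k'}=\tau_k\circ\tau_{k'}$, each $\tau_k$ preserves $\mathbb P$, and every $U\in\mathcal F$ with $\tau_k(U)=U$ for all $k$ has $\mathbb P[U]\in\{0,1\}$. Let $a:\mathbb R^n\times\mathbb R\times\Omega\to\mathbb R$ satisfy the assumption (A): $a$ is $\mathcal B(\mathbb R^{n+1})\otimes\mathcal F$-measurable; $a(x+l,t,\tau_k\omega)=a(x,t+k,\omega)$ for all $x\in\mathbb R^n$, $l\in\mathbb Z^n$, $t\in\mathbb R$, $k\in\mathbb Z$, $\omega\in\Omega$; $a(\cdot,\cdot,\omega)$ is Lipschitz continuous on $\mathbb R^{n+1}$ for each $\omega$; and there are $\alpha,\beta>0$ with $\alpha\le a(x,t,\omega)\le\beta$ for all $x,t,\omega$. For $t\ge 0$ let $\mathcal R_t(x)(\omega)$ be the set of all $\gamma(t)$, where $\gamma:[0,t]\to\mathbb R^n$ is absolutely continuous with $\gamma(0)=x$ and $|\gamma'(r)|\le a(\gamma(r),r,\omega)$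 for a.e. $r\in[0,t]$. Let $Y=[0,1]^n$ and let $\rho$ be the Hausdorff distance. Then there exist a non-empty compact convex set $D\subset\mathbb R^n$ and an event $\widetilde\Omega\in\mathcal F$ with $\mathbb P[\widetilde\Omega]=1$ such that, for every $\omega\in\widetilde\Omega$, $$\lim_{t\to\infty}\ \sup_{x\in Y}\ \rho\Big(\frac{\mathcal R_t(x)(\omega)}{t},D\Big)=0,$$ and, for every $\omega\in\widetilde\Omega$ and every uniformly continuous $u_0:\mathbb R^n\to\mathbb R$, the following hold, where viscosity solutions are understood to be continuous on $\mathbb R^n\times[0,\infty)$. 1. For each $\varepsilon>0$ the problem $u_t+a\big(\tfrac x\varepsilon,\tfrac t\varepsilon,\omega\big)|Du|=0$ in $\mathbb R^n\times(0,\infty)$, $u(\cdot,0)=u_0$, has a unique viscosity solution $u^\varepsilon(\cdot,\cdot,\omega)$. 2. With $\overline H(p)=\sup_{q\in D}p\cdot q$, the problem $\overline u_t+\overline H(D\overline u)=0$ in $\mathbb R^n\times(0,\infty)$, $\overline u(\cdot,0)=u_0$, has a unique viscosity solution, and it is given by $\overline u(x,t)=\inf\{u_0(y)\,:\,x\in y+tD\}$.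 3. As $\varepsilon\to0^+$, $u^\varepsilon(\cdot,\cdot,\omega)$ converges to $\overline u$ locally uniformly in $\mathbb R^n\times[0,\infty)$. -/

import Mathlib

open Set Filter Topology MeasureTheory
open scoped Pointwise ENNReal

noncomputable section

namespace StochHom

/-- The Euclidean space `ℝⁿ`. -/
abbrev E (n : ℕ) : Type := EuclideanSpace ℝ (Fin n)

/-- The point of `ℝⁿ` with the given integer coordinates. -/
def intVec {n : ℕ} (l : Fin n → ℤ) : E n := WithLp.toLp 2 (fun i => (l i : ℝ))

/-- The unit cell `[0,1]ⁿ`. -/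
def unitCell (n : ℕ) : Set (E n) := {x | ∀ i, x i ∈ Icc (0 : ℝ) 1}

/-- `(τ_k)_{k ∈ ℤ}` is an ergodic group of measure preserving transformations of `(Ω, P)`. -/
structure IsErgodicGroup {Ω : Type*} [MeasurableSpace Ω] (P : Measure Ω) (τ : ℤ → Ω → Ω) :
    Prop where
  zero : τ 0 = id
  add : ∀ k k' : ℤ, τ (k + k') = τ k ∘ τ k'
  measurePreserving : ∀ k : ℤ, MeasurePreserving (τ k) P P
  ergodic : ∀ U : Set Ω, MeasurableSet U → (∀ k : ℤ, τ k '' U = U) → P U = 1 ∨ P U = 0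

/-- The standing assumption (A) on the velocity `a = a(x,t,ω)`: joint measurability, periodicity
in `x` and stationarity in `t`, Lipschitz continuity in `(x,t)` for each `ω`, and uniform
positive bounds. -/
structure IsAdmissibleVelocity {n : ℕ} {Ω : Type*} [MeasurableSpace Ω] (τ : ℤ → Ω → Ω)
    (a : E n → ℝ → Ω → ℝ) : Prop where
  measurable : Measurable (fun z : (E n × ℝ) × Ω => a z.1.1 z.1.2 z.2)
  stationary : ∀ (x : E n) (l : Fin n → ℤ) (t : ℝ) (k : ℤ) (ω : Ω),
    a (x + intVec l) t (τ k ω) = a x (t + k) ω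
  lipschitz : ∀ ω : Ω, ∃ K : NNReal, LipschitzWith K (fun z : E n × ℝ => a z.1 z.2 ω)
  bounds : ∃ α β : ℝ, 0 < α ∧ 0 < β ∧ ∀ (x : E n) (t : ℝ) (ω : Ω), α ≤ a x t ω ∧ a x t ω ≤ β

/-- Admissible paths on `[s,t]` for a velocity `c = c(x,r)`: absolutely continuous paths with
`|γ'(r)| ≤ c(γ(r), r)` for a.e. `r ∈ [s,t]`. Only the values of `γ` on `[s,t]` matter. -/
def IsAdmissiblePath {n : ℕ} (c : E n → ℝ → ℝ) (s t : ℝ) (γ : ℝ → E n) : Prop :=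
  AbsolutelyContinuousOnInterval γ s t ∧
    ∀ᵐ r ∂(volume.restrict (Icc s t)), ∃ v : E n, HasDerivAt γ v r ∧ ‖v‖ ≤ c (γ r) r

/-- The set of points reachable at time `t` along admissible paths that start at `x` at
time `0`. -/
def reachableSet {n : ℕ} (c : E n → ℝ → ℝ) (t : ℝ) (x : E n) : Set (E n) :=
  {y | ∃ γ : ℝ → E n, IsAdmissiblePath c 0 t γ ∧ γ 0 = x ∧ γ t = y}

/-- `u` is a (continuous) viscosity solution of `u_t + H(x,t,Du) = 0` in `ℝⁿ × (0,∞)` with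
`u(·,0) = u₀`. Only the values of `u` on `ℝⁿ × [0,∞)` matter. -/
structure IsViscositySolution {n : ℕ} (H : E n → ℝ → E n → ℝ) (u₀ : E n → ℝ)
    (u : E n × ℝ → ℝ) : Prop where
  continuousOn : ContinuousOn u (univ ×ˢ Ici (0 : ℝ))
  initial : ∀ x : E n, u (x, 0) = u₀ x
  subsolution : ∀ φ : E n × ℝ → ℝ, ContDiff ℝ 1 φ → ∀ (x : E n) (t : ℝ), 0 < t →
    IsLocalMax (fun z => u z - φ z) (x, t) →
      deriv (fun s => φ (x, s)) t + H x t (gradient (fun y => φ (y, t)) x) ≤ 0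
  supersolution : ∀ φ : E n × ℝ → ℝ, ContDiff ℝ 1 φ → ∀ (x : E n) (t : ℝ), 0 < t →
    IsLocalMin (fun z => u z - φ z) (x, t) →
      0 ≤ deriv (fun s => φ (x, s)) t + H x t (gradient (fun y => φ (y, t)) x)

/-- The problem has a viscosity solution `u`, and it is unique on `ℝⁿ × [0,∞)`. -/
def IsUniqueViscositySolution {n : ℕ} (H : E n → ℝ → E n → ℝ) (u₀ : E n → ℝ)
    (u : E n × ℝ → ℝ) : Prop :=
  IsViscositySolution H u₀ u ∧
    ∀ v : E n × ℝ → ℝ, IsViscositySolution H u₀ v → EqOn v u (univ ×ˢ Ici (0 : ℝ))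

/-- The oscillatory Hamiltonian `a(x/ε, t/ε) |p|` for a velocity `c = c(x,t)`. -/
def oscHamiltonian {n : ℕ} (c : E n → ℝ → ℝ) (ε : ℝ) : E n → ℝ → E n → ℝ :=
  fun x t p => c (ε⁻¹ • x) (t / ε) * ‖p‖

/-- The effective Hamiltonian `H̄(p) = sup_{q ∈ D} p · q`. -/
def effHamiltonian {n : ℕ} (D : Set (E n)) (p : E n) : ℝ :=
  sSup ((fun q : E n => inner ℝ p q) '' D)

/-- `ū(x,t) = inf {u₀(y) : x ∈ y + tD}`. -/
def hopfLax {n : ℕ} (D : Set (E n)) (u₀ : E n → ℝ) (z : E n × ℝ) : ℝ :=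
  sInf (u₀ '' {y : E n | ∃ q ∈ D, z.1 = y + z.2 • q})

end StochHom

end

/-! The proof is a shape theorem for reachable sets, transferred to the equations through control
representations of their solutions.

Shape theorem. Since `a` is `ℤⁿ`-periodic in space and at least `α`, a path can spend time `√n / α`
going from any point to an integer translate of another path and then follow that translate.
Reachable displacements therefore do not depend on the starting point, up to a constant
(`Reach.exists_of_start`). For a fixed direction `p`, the support function of the set reachable
during `[s,t]` is then additive in time up to a constant, and by stationarity it is a process over
`τ 1`. An ergodic theorem for almost additive sequences, a consequence of Birkhoff's theorem, gives
almost surely a deterministic rate `h p`, simultaneously for all `p` in a countable dense set `Q`.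
The limit shape `D` is the Wulff set `{q | ∀ p ∈ Q, p · q ≤ h p}`.

Compactness puts the rescaled reachable sets near `D`. The converse needs convexity in the limit.
Cut `[0,t]` into `m` blocks: the reachable set is, up to an error `O(m)`, a Minkowski sum of `m`
sets of size `O(t / m)`, and an argument of Shapley–Folkman type bounds its distance to its convex
hull by `O(m) + O(t / √m)`. Support functions control the hull, hence the set. Measurability of the
support functions comes from approximating paths by polygons with nodes in a countable set.

Equations. Both problems are solved by the infimum of `u₀` over the points from which `(x,t)` can be
reached (`isViscositySolution_valueFunction`): along admissible paths for the oscillating problem,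
along `x ∈ y + (t - s) D` for the effective one. Uniqueness is a comparison principle with finite
speed of propagation, so no growth condition is needed. After scaling, the shape theorem says that
the two sets of starting points are close, and the uniform continuity of `u₀` makes the infima
close. -/

namespace StochHom

/-! ### Ergodic theorems: maximal inequality, Birkhoff, almost additive sequences -/

section Ergodic

variable {Ω : Type*} {T : Ω → Ω}

/-- The maximum of `0` and the first `n` Birkhoff sums of `g`. -/
def maxBirkhoff (T : Ω → Ω) (g : Ω → ℝ) : ℕ → Ω → ℝ
  | 0, _ => 0
  | n + 1, ω => max 0 (g ω + maxBirkhoff T g n (T ω))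

theorem maxBirkhoff_nonneg (g : Ω → ℝ) (n : ℕ) (ω : Ω) : 0 ≤ maxBirkhoff T g n ω := by
  cases n with
  | zero => exact le_rfl
  | succ n => exact le_max_left _ _

theorem maxBirkhoff_le_succ (g : Ω → ℝ) (n : ℕ) (ω : Ω) :
    maxBirkhoff T g n ω ≤ maxBirkhoff T g (n + 1) ω := by
  induction n generalizing ω with
  | zero => exact maxBirkhoff_nonneg g 1 ω
  | succ n ih =>
    simp only [maxBirkhoff] at ih ⊢
    gcongr
    exact ih (T ω)

theorem birkhoffSum_le_maxBirkhoff (g : Ω → ℝ) (n : ℕ) (ω : Ω) :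
    birkhoffSum T g n ω ≤ maxBirkhoff T g n ω := by
  induction n generalizing ω with
  | zero => simp [maxBirkhoff]
  | succ n ih =>
    rw [birkhoffSum_succ', maxBirkhoff]
    exact le_max_of_le_right (by gcongr; exact ih _)

theorem maxBirkhoff_le {g : Ω → ℝ} {G : ℝ} (hG : ∀ ω, |g ω| ≤ G) (n : ℕ) (ω : Ω) :
    maxBirkhoff T g n ω ≤ n * G := by
  have hG0 : 0 ≤ G := (abs_nonneg _).trans (hG ω)
  induction n generalizing ω with
  | zero => simp [maxBirkhoff]
  | succ n ih =>
    have h1 := (le_abs_self _).trans (hG ω)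
    have h2 := ih (T ω)
    rw [maxBirkhoff]
    push_cast
    exact max_le (by positivity) (by linarith)

theorem sum_range_shift_sub (f : ℕ → ℝ) (k N : ℕ) :
    ∑ j ∈ Finset.range N, (f (j + k) - f j) = ∑ i ∈ Finset.range k, (f (N + i) - f i) := by
  rw [Finset.sum_sub_distrib, Finset.sum_sub_distrib]
  have h1 := Finset.sum_range_add f k N
  have h2 := Finset.sum_range_add f N k
  rw [add_comm N k] at h2
  simp only [add_comm _ k]
  linarith

/-- Replace each `f k (T^[j] ω)` by `f (j + k) ω - f j ω`, at cost `C`. The sum over `j < N`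
telescopes to the `k` differences `f (N + i) ω - f i ω` with `i < k`, each of which is `f N ω` up to
an error independent of `N`. This reduces the asymptotics of `f N` to Birkhoff averages of the
single function `f k`. -/
theorem abs_birkhoffSum_sub_le {f : ℕ → Ω → ℝ} {B C : ℝ} (hB : ∀ n ω, |f n ω| ≤ B * n)
    (hC : ∀ m n ω, |f (m + n) ω - f m ω - f n (T^[m] ω)| ≤ C) (k N : ℕ) (ω : Ω) :
    |birkhoffSum T (f k) N ω - k * f N ω| ≤ N * C + k * (2 * (B * k) + C) := by
  have hB0 : 0 ≤ B := by
    have := (abs_nonneg _).trans (hB 1 ω)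
    simpa using this
  have h1 : |birkhoffSum T (f k) N ω - ∑ j ∈ Finset.range N, (f (j + k) ω - f j ω)| ≤ N * C := by
    rw [birkhoffSum, ← Finset.sum_sub_distrib]
    refine (Finset.abs_sum_le_sum_abs _ _).trans ?_
    refine (Finset.sum_le_sum (g := fun _ => C) fun j _ => ?_).trans (by simp)
    have := hC j k ω
    rw [← abs_neg]
    exact (congrArg abs (by ring)).trans_le this
  have h2 : |∑ i ∈ Finset.range k, (f (N + i) ω - f i ω) - k * f N ω| ≤
      k * (2 * (B * k) + C) := by
    have h3 : (k : ℝ) * f N ω = ∑ i ∈ Finset.range k, f N ω := by simp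
    rw [h3, ← Finset.sum_sub_distrib]
    refine (Finset.abs_sum_le_sum_abs _ _).trans ?_
    refine (Finset.sum_le_sum (g := fun _ => 2 * (B * k) + C) fun i hi => ?_).trans
      (by simp [mul_add])
    have hik : B * i ≤ B * k := by
      have : (i : ℝ) ≤ k := by exact_mod_cast (Finset.mem_range.1 hi).le
      gcongr
    have h4 := abs_le.1 (hC N i ω)
    have h5 := abs_le.1 (hB i ω)
    have h6 := abs_le.1 (hB i (T^[N] ω))
    exact abs_le.2 ⟨by linarith, by linarith⟩
  rw [← sum_range_shift_sub (fun n => f n ω)] at h2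
  have := abs_le.1 h1
  have := abs_le.1 h2
  exact abs_le.2 ⟨by linarith, by linarith⟩

variable [MeasurableSpace Ω] {P : Measure Ω}

theorem measurable_maxBirkhoff (hT : Measurable T) {g : Ω → ℝ} (hg : Measurable g) (n : ℕ) :
    Measurable (maxBirkhoff T g n) := by
  induction n with
  | zero => exact measurable_const
  | succ n ih => exact measurable_const.max (hg.add (ih.comp hT))

theorem integrable_of_abs_le [IsFiniteMeasure P] {g : Ω → ℝ} (hg : Measurable g) {G : ℝ}
    (hG : ∀ ω, |g ω| ≤ G) : Integrable g P :=
  Integrable.of_bound hg.aestronglyMeasurable G (Eventually.of_forall hG)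

/-- The maximal ergodic inequality. -/
theorem setIntegral_maxBirkhoff_nonneg [IsFiniteMeasure P] (hT : MeasurePreserving T P P)
    {g : Ω → ℝ} (hg : Measurable g) {G : ℝ} (hG : ∀ ω, |g ω| ≤ G) (n : ℕ) :
    0 ≤ ∫ ω in {ω | 0 < maxBirkhoff T g n ω}, g ω ∂P := by
  cases n with
  | zero => simp [maxBirkhoff]
  | succ n =>
    set M := maxBirkhoff T g (n + 1) with hM
    have hMm : Measurable M := measurable_maxBirkhoff hT.measurable hg _
    have hMi : Integrable M P := integrable_of_abs_le hMm (G := (n + 1 : ℕ) * G) fun ω => by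
      rw [abs_of_nonneg (maxBirkhoff_nonneg g _ ω)]
      exact maxBirkhoff_le hG _ ω
    have hMT : Integrable (fun ω => M (T ω)) P := hT.integrable_comp_of_integrable hMi
    have hs : MeasurableSet {ω | 0 < M ω} := measurableSet_lt measurable_const hMm
    have h1 : ∫ ω in {ω | 0 < M ω}, M ω ∂P = ∫ ω, M ω ∂P :=
      setIntegral_eq_integral_of_forall_compl_eq_zero fun ω hω =>
        le_antisymm (not_lt.1 hω) (maxBirkhoff_nonneg g _ ω)
    have h2 : ∫ ω in {ω | 0 < M ω}, M (T ω) ∂P ≤ ∫ ω, M (T ω) ∂P :=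
      setIntegral_le_integral hMT (Eventually.of_forall fun ω => maxBirkhoff_nonneg g _ _)
    have h3 : ∫ ω, M (T ω) ∂P = ∫ ω, M ω ∂P := by
      have := integral_map (μ := P) hT.measurable.aemeasurable
        (f := M) (hT.map_eq.symm ▸ hMm.aestronglyMeasurable)
      rw [hT.map_eq] at this
      exact this.symm
    -- Where `M > 0` the maximum is attained by the second term, so `M = g + M_n ∘ T ≤ g + M ∘ T`.
    -- By invariance of `P`, the integral of `M - M ∘ T` over this set is nonnegative.
    have h4 : ∫ ω in {ω | 0 < M ω}, (M ω - M (T ω)) ∂P ≤ ∫ ω in {ω | 0 < M ω}, g ω ∂P := by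
      refine setIntegral_mono_on (hMi.sub hMT).integrableOn
        (integrable_of_abs_le hg hG).integrableOn hs fun ω hω => ?_
      have h5 : M ω = g ω + maxBirkhoff T g n (T ω) := by
        have : M ω = max 0 (g ω + maxBirkhoff T g n (T ω)) := rfl
        rw [this]
        refine max_eq_right (le_of_lt ?_)
        have h6 : 0 < M ω := hω
        rw [this] at h6
        exact (lt_max_iff.1 h6).resolve_left (lt_irrefl _)
      have h6 := maxBirkhoff_le_succ (T := T) g n (T ω)
      rw [h5]
      linarith
    rw [integral_sub hMi.integrableOn hMT.integrableOn] at h4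
    linarith

/-- The set where the maximal sums are unbounded is invariant, because `g` is bounded. If it had
full measure, the sets `{maxBirkhoff T g n > 0}` would exhaust the space and the maximal inequality
would give `∫ g ≥ 0` in the limit. -/
theorem ae_exists_birkhoffSum_le [IsProbabilityMeasure P] (hT : MeasurePreserving T P P)
    (herg : ∀ U : Set Ω, MeasurableSet U → T ⁻¹' U = U → P U = 1 ∨ P U = 0)
    {g : Ω → ℝ} (hg : Measurable g) {G : ℝ} (hG : ∀ ω, |g ω| ≤ G) (hneg : ∫ ω, g ω ∂P < 0) :
    ∀ᵐ ω ∂P, ∃ C, ∀ n, birkhoffSum T g n ω ≤ C := by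
  set B : Set Ω := {ω | ∀ C : ℕ, ∃ n, (C : ℝ) < maxBirkhoff T g n ω} with hB
  have hMm := measurable_maxBirkhoff hT.measurable hg
  have hBm : MeasurableSet B := by
    have : B = ⋂ C : ℕ, ⋃ n, {ω | (C : ℝ) < maxBirkhoff T g n ω} := by
      ext; simp [hB]
    rw [this]
    exact MeasurableSet.iInter fun C => MeasurableSet.iUnion fun n =>
      measurableSet_lt measurable_const (hMm n)
  have hinv : T ⁻¹' B = B := by
    ext ω
    simp only [hB, mem_preimage, mem_ofPred_eq]
    have h1 := abs_le.1 (hG ω)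
    constructor
    · intro h C
      obtain ⟨N, hN⟩ := exists_nat_gt ((C : ℝ) + G)
      obtain ⟨n, hn⟩ := h N
      refine ⟨n + 1, ?_⟩
      rw [maxBirkhoff]
      exact lt_max_of_lt_right (by linarith)
    · intro h C
      obtain ⟨N, hN⟩ := exists_nat_gt ((C : ℝ) + G)
      obtain ⟨n, hn⟩ := h N
      refine ⟨n, ?_⟩
      have h2 := hn.trans_le (maxBirkhoff_le_succ g n ω)
      rw [maxBirkhoff] at h2
      rcases lt_max_iff.1 h2 with h3 | h3
      · exact absurd h3 (not_lt.2 (Nat.cast_nonneg N))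
      · linarith
  rcases herg B hBm hinv with h | h
  · exfalso
    have hlim : Tendsto (fun n => ∫ ω in {ω | 0 < maxBirkhoff T g n ω}, g ω ∂P) atTop
        (𝓝 (∫ ω in ⋃ n, {ω | 0 < maxBirkhoff T g n ω}, g ω ∂P)) :=
      tendsto_setIntegral_of_monotone
        (fun n => measurableSet_lt measurable_const (hMm n))
        (monotone_nat_of_le_succ fun n ω hω => lt_of_lt_of_le hω (maxBirkhoff_le_succ g n ω))
        (integrable_of_abs_le hg hG).integrableOn
    have huniv : (⋃ n, {ω | 0 < maxBirkhoff T g n ω} : Set Ω) =ᵐ[P] univ := by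
      have hae : ∀ᵐ ω ∂P, ω ∈ B := (mem_ae_iff_prob_eq_one hBm).2 h
      filter_upwards [hae] with ω hω
      obtain ⟨n, hn⟩ := hω 0
      exact propext ⟨fun _ => trivial, fun _ => mem_iUnion.2 ⟨n, by simpa using hn⟩⟩
    rw [setIntegral_congr_set huniv, setIntegral_univ] at hlim
    exact absurd (ge_of_tendsto' hlim fun n => setIntegral_maxBirkhoff_nonneg hT hg hG n)
      (not_le.2 hneg)
  · have hae : ∀ᵐ ω ∂P, ω ∉ B := measure_eq_zero_iff_ae_notMem.1 h
    filter_upwards [hae] with ω hω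
    simp only [hB, mem_ofPred_eq, not_forall, not_exists, not_lt] at hω
    obtain ⟨C, hC⟩ := hω
    exact ⟨C, fun n => (birkhoffSum_le_maxBirkhoff g n ω).trans (hC n)⟩

theorem ae_eventually_birkhoffSum_le [IsProbabilityMeasure P] (hT : MeasurePreserving T P P)
    (herg : ∀ U : Set Ω, MeasurableSet U → T ⁻¹' U = U → P U = 1 ∨ P U = 0)
    {f : Ω → ℝ} (hf : Measurable f) {G : ℝ} (hG : ∀ ω, |f ω| ≤ G) {η : ℝ} (hη : 0 < η) :
    ∀ᵐ ω ∂P, ∀ᶠ n : ℕ in atTop, birkhoffSum T f n ω ≤ n * ((∫ ω, f ω ∂P) + η) := by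
  set I := ∫ ω, f ω ∂P
  have hfi := integrable_of_abs_le (P := P) hf hG
  have hneg : ∫ ω, (f ω - (I + η / 2)) ∂P < 0 := by
    rw [integral_sub hfi (integrable_const _)]
    simp only [integral_const, probReal_univ, one_smul]
    change I - (I + η / 2) < 0
    linarith
  filter_upwards [ae_exists_birkhoffSum_le hT herg (hf.sub_const (I + η / 2))
    (G := G + |I + η / 2|) (fun ω => (abs_sub _ _).trans (by linarith [hG ω])) hneg] with ω ⟨C, hC⟩
  filter_upwards [eventually_ge_atTop ⌈C / (η / 2)⌉₊] with n hn
  have h1 : C ≤ n * (η / 2) := by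
    have := Nat.ceil_le.1 hn
    rwa [div_le_iff₀ (by positivity)] at this
  have h2 := hC n
  have h3 : birkhoffSum T (fun ω => f ω - (I + η / 2)) n ω
      = birkhoffSum T f n ω - n * (I + η / 2) := by
    simp [birkhoffSum, Finset.sum_sub_distrib, mul_add]
  rw [h3] at h2
  linarith

/-- Birkhoff's pointwise ergodic theorem for bounded functions. -/
theorem ae_eventually_abs_birkhoffSum_sub_le [IsProbabilityMeasure P]
    (hT : MeasurePreserving T P P)
    (herg : ∀ U : Set Ω, MeasurableSet U → T ⁻¹' U = U → P U = 1 ∨ P U = 0)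
    {f : Ω → ℝ} (hf : Measurable f) {G : ℝ} (hG : ∀ ω, |f ω| ≤ G) {η : ℝ} (hη : 0 < η) :
    ∀ᵐ ω ∂P, ∀ᶠ n : ℕ in atTop, |birkhoffSum T f n ω - n * ∫ ω, f ω ∂P| ≤ n * η := by
  filter_upwards [ae_eventually_birkhoffSum_le hT herg hf hG hη,
    ae_eventually_birkhoffSum_le hT herg hf.neg (G := G) (by simpa using hG) hη] with ω h1 h2
  filter_upwards [h1, h2] with n h3 h4
  have h5 : birkhoffSum T (-f) n ω = - birkhoffSum T f n ω := by simp [birkhoffSum]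
  have h6 : ∫ ω, (-f) ω ∂P = - ∫ ω, f ω ∂P := integral_neg _
  rw [h6, h5] at h4
  exact abs_le.2 ⟨by linarith, by linarith⟩

/-- An ergodic theorem for sequences which are additive up to a bounded error. -/
theorem exists_ae_tendsto_of_almost_additive [IsProbabilityMeasure P]
    (hT : MeasurePreserving T P P)
    (herg : ∀ U : Set Ω, MeasurableSet U → T ⁻¹' U = U → P U = 1 ∨ P U = 0)
    {f : ℕ → Ω → ℝ} {B C : ℝ} (hf : ∀ n, Measurable (f n)) (hB : ∀ n ω, |f n ω| ≤ B * n)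
    (hC : ∀ m n ω, |f (m + n) ω - f m ω - f n (T^[m] ω)| ≤ C) :
    ∃ h : ℝ, ∀ᵐ ω ∂P, Tendsto (fun N : ℕ => f N ω / N) atTop (𝓝 h) := by
  obtain ⟨ω₀⟩ : Nonempty Ω := nonempty_of_isProbabilityMeasure P
  have hC0 : 0 ≤ C := (abs_nonneg _).trans (hC 0 0 ω₀)
  have hB0 : 0 ≤ B := by simpa using (abs_nonneg _).trans (hB 1 ω₀)
  -- Birkhoff averages of `f (k + 1)`, normalised by the block length. The index is shifted to avoid
  -- division by zero.
  set I : ℕ → ℝ := fun k => (∫ ω, f (k + 1) ω ∂P) / (k + 1)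
  -- `C` for almost additivity, `1` for the Birkhoff error, and `1` for the terms independent of
  -- `N`, which are at most `N` for large `N`.
  set D := C + 2
  have key : ∀ᵐ ω ∂P, ∀ k : ℕ, ∀ᶠ N : ℕ in atTop, |f N ω / N - I k| ≤ D / (k + 1) := by
    rw [ae_all_iff]
    intro k
    filter_upwards [ae_eventually_abs_birkhoffSum_sub_le hT herg (hf (k + 1)) (hB (k + 1))
      one_pos] with ω hω
    filter_upwards [hω, eventually_ge_atTop ⌈((k + 1 : ℕ) : ℝ) * (2 * (B * (k + 1 : ℕ)) + C)⌉₊,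
      eventually_gt_atTop 0] with N h1 h2 h3
    have h2 := Nat.ceil_le.1 h2
    have h4 := abs_birkhoffSum_sub_le hB hC (k + 1) N ω
    have hN : (0 : ℝ) < N := by exact_mod_cast h3
    have hk : (0 : ℝ) < (k : ℝ) + 1 := by positivity
    have h5 : f N ω / N - I k =
        (((k + 1 : ℕ) : ℝ) * f N ω - N * ∫ ω, f (k + 1) ω ∂P) / (N * (k + 1)) := by
      simp only [I]
      push_cast
      field_simp
    rw [h5, abs_div, abs_of_pos (mul_pos hN hk), div_le_div_iff₀ (mul_pos hN hk) hk]
    have h6 : |((k + 1 : ℕ) : ℝ) * f N ω - N * ∫ ω, f (k + 1) ω ∂P| ≤ D * N := by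
      have := abs_le.1 h1
      have := abs_le.1 h4
      simp only [D]
      exact abs_le.2 ⟨by linarith, by linarith⟩
    calc _ ≤ D * N * (k + 1) := by gcongr
      _ = _ := by ring
  -- The numbers `I j` are deterministic, so a single good `ω` suffices to compare them.
  have hI : ∀ j k, |I j - I k| ≤ D / (j + 1) + D / (k + 1) := by
    obtain ⟨ω, hω⟩ := key.exists
    intro j k
    obtain ⟨N, h1, h2⟩ := ((hω j).and (hω k)).exists
    have := abs_le.1 h1
    have := abs_le.1 h2
    exact abs_le.2 ⟨by linarith, by linarith⟩
  have hD : Tendsto (fun k : ℕ => D / ((k : ℝ) + 1)) atTop (𝓝 0) :=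
    tendsto_const_div_atTop_nhds_zero_nat D |>.comp (tendsto_add_atTop_nat 1) |>.congr
      fun k => by simp
  have hcau : CauchySeq I := by
    refine cauchySeq_of_le_tendsto_0 (fun k : ℕ => D / ((k : ℝ) + 1) + D / ((k : ℝ) + 1)) ?_
      (by simpa using hD.add hD)
    intro j k N hj hk
    refine (hI j k).trans ?_
    have hDp : 0 ≤ D := by positivity
    gcongr
  obtain ⟨h, hh⟩ := cauchySeq_tendsto_of_complete hcau
  have hIh : ∀ k, |I k - h| ≤ D / (k + 1) := by
    intro k
    have h1 : Tendsto (fun j => |I k - I j|) atTop (𝓝 |I k - h|) := (hh.const_sub (I k)).abs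
    have h2 : Tendsto (fun j : ℕ => D / ((k : ℝ) + 1) + D / ((j : ℝ) + 1)) atTop
        (𝓝 (D / ((k : ℝ) + 1) + 0)) := hD.const_add _
    simpa using le_of_tendsto_of_tendsto' h1 h2 (hI k)
  refine ⟨h, ?_⟩
  filter_upwards [key] with ω hω
  rw [Metric.tendsto_atTop]
  intro ε hε
  obtain ⟨k, hk⟩ := (((hD.add hD).congr fun _ => rfl).eventually
    (gt_mem_nhds (show (0 : ℝ) + 0 < ε by simpa using hε))).exists
  obtain ⟨N, hN⟩ := eventually_atTop.1 (hω k)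
  refine ⟨N, fun m hm => ?_⟩
  rw [Real.dist_eq]
  have := abs_le.1 (hN m hm)
  have := abs_le.1 (hIh k)
  exact abs_lt.2 ⟨by linarith, by linarith⟩

end Ergodic

end StochHom

/-! ### The comparison principle by doubling of variables -/

namespace StochHom

variable {n : ℕ}

/-- Serves both test functions of the doubling argument: `d`, `e`, `f` absorb the terms that depend
on time only, and the supersolution side uses `-δ` for `δ` and `m = 0`. -/
theorem hasGradientAt_quadratic_add_barrier (x y x₁ : E n) (δ m l d e f : ℝ) :
    HasGradientAt (fun z : E n => (‖z - y‖ ^ 2 + d) / (2 * δ) + e +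
        m * Real.exp (l * (√(1 + ‖z - x₁‖ ^ 2) + f)))
      (δ⁻¹ • (x - y) + (m * l * Real.exp (l * (√(1 + ‖x - x₁‖ ^ 2) + f)) *
        (√(1 + ‖x - x₁‖ ^ 2))⁻¹) • (x - x₁)) x := by
  rw [hasGradientAt_iff_hasFDerivAt]
  have hsub : ∀ a : E n, HasFDerivAt (fun z : E n => z - a) (ContinuousLinearMap.id ℝ (E n)) x :=
    fun a => (hasFDerivAt_id x).sub_const a
  have h1 := (((hsub y).norm_sq.add_const d).mul_const (2 * δ)⁻¹).add_const e
  have h2 := (((((hsub x₁).norm_sq.const_add 1).sqrt (by positivity)).add_const f).const_mul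
    l).exp.const_mul m
  simp only [div_eq_mul_inv]
  refine (h1.add h2).congr_fderiv ?_
  ext w
  simp only [add_apply, smul_apply, smul_eq_mul,
    ContinuousLinearMap.comp_apply, ContinuousLinearMap.id_apply, innerSL_apply_apply,
    InnerProductSpace.toDual_apply_apply, inner_add_left, real_inner_smul_left]
  ring_nf

/-- The error from the dependence of `H` on `(x,t)` is controlled by the penalty itself, which is
small at the maximum point. -/
theorem mul_norm_smul_le_quadratic {K δ : ℝ} (hK : 0 ≤ K) (hδ : 0 < δ) (x y : E n) (t s : ℝ) :
    K * (‖x - y‖ + |t - s|) * ‖δ⁻¹ • (x - y)‖ ≤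
      4 * K * ((‖x - y‖ ^ 2 + (t - s) ^ 2) / (2 * δ)) := by
  have hδ' : 0 < δ⁻¹ := inv_pos.2 hδ
  rw [norm_smul, Real.norm_eq_abs, abs_of_pos hδ']
  have h5 : (‖x - y‖ + |t - s|) * ‖x - y‖ ≤ 2 * (‖x - y‖ ^ 2 + (t - s) ^ 2) := by
    rw [← sq_abs (t - s)]
    nlinarith [sq_nonneg (‖x - y‖ - |t - s|), sq_nonneg ‖x - y‖, sq_nonneg |t - s|]
  calc _ = K * δ⁻¹ * ((‖x - y‖ + |t - s|) * ‖x - y‖) := by ring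
    _ ≤ K * δ⁻¹ * (2 * (‖x - y‖ ^ 2 + (t - s) ^ 2)) := by gcongr
    _ = _ := by field_simp; ring

set_option maxHeartbeats 1000000 in
/-- Local comparison principle: continuous sub- and supersolutions are ordered on
`ℝⁿ × [0,∞)` if they are so initially. -/
theorem viscosity_comparison {H : E n → ℝ → E n → ℝ} {β K : ℝ} (hβ : 0 < β) (hK : 0 ≤ K)
    (hp : ∀ x t p q, |H x t p - H x t q| ≤ β * ‖p - q‖)
    (hx : ∀ x y t s p, |H x t p - H y s p| ≤ K * (‖x - y‖ + |t - s|) * ‖p‖)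
    {u v : E n × ℝ → ℝ} (hu : ContinuousOn u (univ ×ˢ Ici (0 : ℝ)))
    (hv : ContinuousOn v (univ ×ˢ Ici (0 : ℝ))) (h0 : ∀ x, u (x, 0) ≤ v (x, 0))
    (hsub : ∀ φ : E n × ℝ → ℝ, ContDiff ℝ 1 φ → ∀ (x : E n) (t : ℝ), 0 < t →
      IsLocalMax (fun z => u z - φ z) (x, t) →
        deriv (fun s => φ (x, s)) t + H x t (gradient (fun y => φ (y, t)) x) ≤ 0)
    (hsup : ∀ φ : E n × ℝ → ℝ, ContDiff ℝ 1 φ → ∀ (x : E n) (t : ℝ), 0 < t →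
      IsLocalMin (fun z => v z - φ z) (x, t) →
        0 ≤ deriv (fun s => φ (x, s)) t + H x t (gradient (fun y => φ (y, t)) x))
    (x : E n) (t : ℝ) (ht : 0 ≤ t) : u (x, t) ≤ v (x, t) := by
  by_contra! hlt
  obtain ⟨x₁, hx₁⟩ : ∃ x₁, x₁ = x := ⟨x, rfl⟩
  obtain ⟨t₁, ht₁⟩ : ∃ t₁, t₁ = t := ⟨t, rfl⟩
  rw [← hx₁, ← ht₁] at hlt
  rw [← ht₁] at ht
  clear hx₁ ht₁ x t
  have ht1 : 0 < t₁ := by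
    rcases ht.eq_or_lt with h | h
    · rw [← h] at hlt
      exact absurd (h0 x₁) (not_le.2 hlt)
    · exact h
  set σ := u (x₁, t₁) - v (x₁, t₁) with hσ
  have hσ0 : 0 < σ := sub_pos.2 hlt
  set R := 1 + β * t₁
  -- The sublevel sets of `w` at nonnegative times are smoothed backward cones of slope `β`, and `w
  -- (x₁, t₁) = R`. For a barrier that is an increasing function of `w`, the time derivative
  -- dominates `β` times the spatial gradient.
  set w : E n × ℝ → ℝ := fun z => √(1 + ‖z.1 - x₁‖ ^ 2) + β * z.2 with hw
  have hwc : Continuous w := by fun_prop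
  set A : Set (E n × ℝ) := {z | 0 ≤ z.2 ∧ w z ≤ R + 2} with hA
  have hAclosed : IsClosed A :=
    (isClosed_le continuous_const continuous_snd).inter (isClosed_le hwc continuous_const)
  have hAc : IsCompact A := by
    refine ((isCompact_closedBall x₁ (R + 2)).prod
      (isCompact_Icc (a := 0) (b := (R + 2) / β))).of_isClosed_subset hAclosed ?_
    rintro ⟨y, s⟩ ⟨hs, hys⟩
    simp only [hw] at hs hys
    have h1 : ‖y - x₁‖ ≤ √(1 + ‖y - x₁‖ ^ 2) := Real.le_sqrt_of_sq_le (by linarith)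
    have h2 : 0 ≤ β * s := by positivity
    have h3 := norm_nonneg (y - x₁)
    refine ⟨?_, hs, ?_⟩
    · rw [mem_closedBall_iff_norm]
      linarith
    · rw [le_div_iff₀ hβ]
      linarith
  have hAsub : A ⊆ univ ×ˢ Ici (0 : ℝ) := fun z hz => ⟨trivial, hz.1⟩
  have hz₁ : (x₁, t₁) ∈ A := ⟨ht, by simp [hw, R]⟩
  have huA := hu.mono hAsub
  have hvA := hv.mono hAsub
  obtain ⟨Mu, hMu⟩ := hAc.exists_bound_of_continuousOn huA
  obtain ⟨Mv, hMv⟩ := hAc.exists_bound_of_continuousOn hvA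
  obtain ⟨M, hM0, hMu, hMv⟩ : ∃ M > 0, (∀ z ∈ A, |u z| ≤ M) ∧ ∀ z ∈ A, |v z| ≤ M :=
    ⟨max (max Mu Mv) 1, by positivity,
      fun z hz => (hMu z hz).trans ((le_max_left _ _).trans (le_max_left _ _)),
      fun z hz => (hMv z hz).trans ((le_max_right _ _).trans (le_max_left _ _))⟩
  -- The barrier `b` equals `m` at `(x₁, t₁)` and exceeds `2 * M` once `w ≥ R + 1`, by the choice of
  -- `l`. Together, `b` and `η * t` cost `σ / 4` at `(x₁, t₁)`.
  set m := σ / 8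
  have hm0 : 0 < m := by positivity
  set l := 2 * M / m
  have hl0 : 0 < l := by positivity
  have hml : 2 * M < m * Real.exp l := by
    have h1 := Real.add_one_le_exp l
    have h2 : m * l = 2 * M := by simp only [l]; field_simp
    nlinarith
  set η := σ / (8 * t₁)
  have hη0 : 0 < η := by positivity
  have hηt : η * t₁ = σ / 8 := by simp only [η]; field_simp
  set b : E n × ℝ → ℝ := fun z => m * Real.exp (l * (w z - R)) with hb
  have hbc : Continuous b := by fun_prop
  have hb0 : ∀ z, 0 < b z := fun z => by positivity
  have hbz : b (x₁, t₁) = m := by simp [hb, hw, R]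
  -- The first bound excludes maxima at time `0`; the second makes `4 * K * o < η` at the end.
  set o := min (σ / 4) (η / (4 * K + 1))
  have ho0 : 0 < o := by positivity
  obtain ⟨r, hr0, hru, hrv, hrw⟩ : ∃ r > 0, (∀ z ∈ A, ∀ z' ∈ A, dist z z' < r → |u z - u z'| < o) ∧
      (∀ z ∈ A, ∀ z' ∈ A, dist z z' < r → |v z - v z'| < o) ∧
      (∀ z ∈ A, ∀ z' ∈ A, dist z z' < r → |w z - w z'| < 1) := by
    have e1 := Metric.uniformContinuousOn_iff.1 (hAc.uniformContinuousOn_of_continuous huA) o ho0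
    have e2 := Metric.uniformContinuousOn_iff.1 (hAc.uniformContinuousOn_of_continuous hvA) o ho0
    have e3 := Metric.uniformContinuousOn_iff.1
      (hAc.uniformContinuousOn_of_continuous hwc.continuousOn) 1 one_pos
    obtain ⟨r1, hr1, e1⟩ := e1
    obtain ⟨r2, hr2, e2⟩ := e2
    obtain ⟨r3, hr3, e3⟩ := e3
    refine ⟨min (min r1 r2) r3, by positivity, fun z hz z' hz' h => e1 z hz z' hz' ?_,
      fun z hz z' hz' h => e2 z hz z' hz' ?_, fun z hz z' hz' h => e3 z hz z' hz' ?_⟩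
    · exact h.trans_le ((min_le_left _ _).trans (min_le_left _ _))
    · exact h.trans_le ((min_le_left _ _).trans (min_le_right _ _))
    · exact h.trans_le (min_le_right _ _)
  -- A penalty of at most `2 * M` then forces the two points to be closer than `r`.
  set δ := r ^ 2 / (8 * M)
  have hδ0 : 0 < δ := by positivity
  set q : E n × ℝ → E n × ℝ → ℝ := fun z z' => (‖z.1 - z'.1‖ ^ 2 + (z.2 - z'.2) ^ 2) / (2 * δ)
    with hq
  have hqc : Continuous fun p : (E n × ℝ) × (E n × ℝ) => q p.1 p.2 := by fun_prop
  have hq0 : ∀ z z', 0 ≤ q z z' := fun z z' => by positivity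
  have hqz : ∀ z, q z z = 0 := fun z => by simp [hq]
  set Φ : (E n × ℝ) × (E n × ℝ) → ℝ := fun p => u p.1 - v p.2 - q p.1 p.2 - η * p.1.2 - b p.1
    with hΦ
  have hΦc : ContinuousOn Φ (A ×ˢ A) := by
    refine ContinuousOn.sub (ContinuousOn.sub (ContinuousOn.sub (ContinuousOn.sub ?_ ?_) ?_) ?_) ?_
    · exact huA.comp continuousOn_fst fun p hp => hp.1
    · exact hvA.comp continuousOn_snd fun p hp => hp.2
    · exact hqc.continuousOn
    · fun_prop
    · exact (hbc.comp continuous_fst).continuousOn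
  obtain ⟨⟨z, z'⟩, ⟨hz, hz'⟩, hmax⟩ := (hAc.prod hAc).exists_isMaxOn ⟨((x₁, t₁), (x₁, t₁)), hz₁, hz₁⟩ hΦc
  simp only at hz hz'
  have hA1 : 3 * σ / 4 ≤ Φ (z, z') := by
    have h1 : Φ ((x₁, t₁), (x₁, t₁)) = 3 * σ / 4 := by
      simp only [hΦ, hqz, hbz, hηt, ← hσ, m]
      ring
    rw [← h1]
    exact hmax ⟨hz₁, hz₁⟩
  -- Comparison with the diagonal pair `(z, z)`: only the modulus of continuity of `v` enters.
  have hB1 : q z z' ≤ v z - v z' := by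
    have h1 : Φ (z, z) ≤ Φ (z, z') := hmax ⟨hz, hz⟩
    simp only [hΦ, hqz] at h1
    linarith
  have hMuz := abs_le.1 (hMu z hz)
  have hMvz := abs_le.1 (hMv z hz)
  have hMvz' := abs_le.1 (hMv z' hz')
  have hdist : dist z z' < r := by
    have h1 : q z z' ≤ 2 * M := by linarith
    simp only [hq] at h1
    rw [div_le_iff₀ (by positivity)] at h1
    have h2 : 2 * M * (2 * δ) = r ^ 2 / 2 := by simp only [δ]; field_simp; norm_num
    have h3 : 0 < r ^ 2 := by positivity
    rw [Prod.dist_eq, max_lt_iff, dist_eq_norm, Real.dist_eq]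
    constructor
    · refine lt_of_pow_lt_pow_left₀ 2 hr0.le ?_
      nlinarith [sq_nonneg (z.2 - z'.2)]
    · refine lt_of_pow_lt_pow_left₀ 2 hr0.le ?_
      rw [sq_abs]
      nlinarith [sq_nonneg ‖z.1 - z'.1‖]
  have huo := abs_lt.1 (hru z hz z' hz' hdist)
  have hvo := abs_lt.1 (hrv z hz z' hz' hdist)
  have hwo := abs_lt.1 (hrw z hz z' hz' hdist)
  have ho1 : o ≤ σ / 4 := min_le_left _ _
  have hA2 : 3 * σ / 4 + η * z.2 + b z ≤ u z - v z' := by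
    have := hq0 z z'
    simp only [hΦ] at hA1
    linarith
  have hηz : 0 ≤ η * z.2 := mul_nonneg hη0.le hz.1
  have hbz0 := hb0 z
  -- At time `0` the ordering of the initial data and closeness of the points would give `u z - v z'
  -- < o ≤ σ / 4`, against `hA2`.
  have hz2 : 0 < z.2 := by
    rcases hz.1.eq_or_lt with h | h
    · have h1 := h0 z.1
      rw [h, Prod.mk.eta] at h1
      linarith
    · exact h
  have hz2' : 0 < z'.2 := by
    rcases hz'.1.eq_or_lt with h | h
    · have h1 := h0 z'.1
      rw [h, Prod.mk.eta] at h1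
      linarith
    · exact h
  -- Here the barrier alone would exceed the oscillation `2 * M`. The maximum is thus interior to
  -- `A` in both variables, as the viscosity tests require.
  have hwz : w z < R + 1 := by
    by_contra! h
    have h1 : m * Real.exp l ≤ b z := by
      simp only [hb]
      gcongr
      nlinarith
    linarith
  have hwz' : w z' < R + 2 := by linarith
  have hnhds : ∀ y : E n × ℝ, 0 < y.2 → w y < R + 2 → A ∈ 𝓝 y := fun y h1 h2 =>
    mem_of_superset (((isOpen_lt continuous_const continuous_snd).inter
      (isOpen_lt hwc continuous_const)).mem_nhds ⟨h1, h2⟩) fun y hy => ⟨hy.1.le, hy.2.le⟩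
  obtain ⟨x, t⟩ := z
  obtain ⟨y, s⟩ := z'
  have hlmax := hsub (fun p => q p (y, s) + η * p.2 + b p)
    (by
      simp only [hq, hb, hw]
      have h1 : ContDiff ℝ 1 fun p : E n × ℝ => √(1 + ‖p.1 - x₁‖ ^ 2) :=
        ContDiff.sqrt (contDiff_const.add ((contDiff_fst.sub contDiff_const).norm_sq ℝ))
          fun p => by positivity
      have h2 : ContDiff ℝ 1 fun p : E n × ℝ => ‖p.1 - y‖ ^ 2 :=
        (contDiff_fst.sub contDiff_const).norm_sq ℝ
      fun_prop) x t hz2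
    (by
      filter_upwards [hnhds (x, t) hz2 (by linarith)] with p hp
      have h1 : Φ (p, (y, s)) ≤ Φ ((x, t), (y, s)) := hmax ⟨hp, hz'⟩
      simp only [hΦ] at h1
      linarith)
  have hlmin := hsup (fun p => - q (x, t) p)
    (by
      simp only [hq]
      have h2 : ContDiff ℝ 1 fun p : E n × ℝ => ‖x - p.1‖ ^ 2 :=
        (contDiff_const.sub contDiff_fst).norm_sq ℝ
      fun_prop) y s hz2'
    (by
      filter_upwards [hnhds (y, s) hz2' hwz'] with p hp
      have h1 : Φ ((x, t), p) ≤ Φ ((x, t), (y, s)) := hmax ⟨hz, hp⟩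
      simp only [hΦ] at h1
      linarith)
  have hexp : ∀ τ : ℝ, l * (√(1 + ‖x - x₁‖ ^ 2) + (β * τ - R)) = l * (w (x, τ) - R) := fun τ => by
    simp only [hw]; ring
  have hd1 : deriv (fun τ => q (x, τ) (y, s) + η * τ + b (x, τ)) t =
      δ⁻¹ * (t - s) + η + l * b (x, t) * β := by
    have h1 : HasDerivAt (fun τ : ℝ => q (x, τ) (y, s)) ((2 * (t - s)) / (2 * δ)) t := by
      have := ((((hasDerivAt_id t).sub_const s).pow 2).const_add (‖x - y‖ ^ 2)).div_const (2 * δ)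
      simpa [hq] using this
    have h2 : HasDerivAt (fun τ : ℝ => b (x, τ)) (m * (Real.exp (l * (w (x, t) - R)) *
        (l * (β * 1)))) t := by
      have := (((((hasDerivAt_id t).const_mul β).const_add (√(1 + ‖x - x₁‖ ^ 2))).sub_const
        R).const_mul l).exp.const_mul m
      simpa [hb, hw] using this
    have h3 : HasDerivAt (fun τ => q (x, τ) (y, s) + η * τ + b (x, τ)) _ t :=
      (h1.add ((hasDerivAt_id t).const_mul η)).add h2
    rw [h3.deriv]
    simp only [hb]
    field_simp
  have hg1 := hasGradientAt_quadratic_add_barrier x y x₁ δ m l ((t - s) ^ 2) (η * t) (β * t - R)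
  have hd2 : deriv (fun τ => - q (x, t) (y, τ)) s = δ⁻¹ * (t - s) := by
    have h1 : HasDerivAt (fun τ : ℝ => -q (x, t) (y, τ)) (-((2 * (t - s) * (-1)) / (2 * δ))) s := by
      have := (((((hasDerivAt_id s).const_sub t).pow 2).const_add (‖x - y‖ ^ 2)).div_const
        (2 * δ)).fun_neg
      simpa [hq] using this
    rw [h1.deriv]
    field_simp
  have hg2 : gradient (fun a => - q (x, t) (a, s)) y = δ⁻¹ • (x - y) := by
    have h1 := hasGradientAt_quadratic_add_barrier y x x₁ (-δ) 0 l ((t - s) ^ 2) 0 0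
    have h2 : (fun a => - q (x, t) (a, s)) = fun a => (‖a - x‖ ^ 2 + (t - s) ^ 2) / (2 * -δ) + 0 +
        0 * Real.exp (l * (√(1 + ‖a - x₁‖ ^ 2) + 0)) := by
      ext a
      simp only [hq, norm_sub_rev x a]
      rw [mul_neg, div_neg]
      ring
    rw [h2, h1.gradient]
    rw [zero_mul, zero_mul, zero_mul, zero_smul, add_zero, inv_neg, neg_smul, ← smul_neg, neg_sub]
  simp only [hexp] at hg1
  have hg1' : gradient (fun a => q (a, t) (y, s) + η * t + b (a, t)) x =
      δ⁻¹ • (x - y) + (m * l * Real.exp (l * (w (x, t) - R)) *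
        (√(1 + ‖x - x₁‖ ^ 2))⁻¹) • (x - x₁) := by
    rw [← hg1.gradient]
    congr 1
    ext a
    simp only [hq, hb, hw]
    ring_nf
  simp only at hlmax hlmin
  rw [hd1, hg1'] at hlmax
  rw [hd2, hg2] at hlmin
  have hn : ‖(m * l * Real.exp (l * (w (x, t) - R)) * (√(1 + ‖x - x₁‖ ^ 2))⁻¹) • (x - x₁)‖ ≤
      l * b (x, t) := by
    have h1 : ‖x - x₁‖ ≤ √(1 + ‖x - x₁‖ ^ 2) := Real.le_sqrt_of_sq_le (by linarith)
    have h2 : 0 < √(1 + ‖x - x₁‖ ^ 2) := by positivity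
    rw [norm_smul, Real.norm_eq_abs, abs_of_nonneg (by positivity), mul_assoc]
    calc _ ≤ m * l * Real.exp (l * (w (x, t) - R)) * 1 := by
          gcongr
          rw [inv_mul_le_iff₀ h2]
          linarith
      _ = _ := by simp only [hb]; ring
  have hH1 := abs_le.1 (hp x t (δ⁻¹ • (x - y) +
    (m * l * Real.exp (l * (w (x, t) - R)) * (√(1 + ‖x - x₁‖ ^ 2))⁻¹) • (x - x₁)) (δ⁻¹ • (x - y)))
  rw [add_sub_cancel_left] at hH1
  have hH2 := abs_le.1 (hx x y t s (δ⁻¹ • (x - y)))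
  have hn' := mul_le_mul_of_nonneg_left hn hβ.le
  -- Subtracting the two viscosity inequalities, the time derivatives of `q` cancel, and the term `l
  -- * b * β` from the barrier's time derivative pays for its spatial gradient. Only `η` is left.
  have hfin : η ≤ K * (‖x - y‖ + |t - s|) * ‖δ⁻¹ • (x - y)‖ := by linarith
  have hqo : q (x, t) (y, s) < o := by linarith
  have h4 : K * (‖x - y‖ + |t - s|) * ‖δ⁻¹ • (x - y)‖ ≤ 4 * K * q (x, t) (y, s) :=
    mul_norm_smul_le_quadratic hK hδ0 x y t s
  have h5 : o ≤ η / (4 * K + 1) := min_le_right _ _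
  rw [le_div_iff₀ (by positivity)] at h5
  have h6 : 4 * K * q (x, t) (y, s) ≤ 4 * K * o := by gcongr
  linarith

theorem isUniqueViscositySolution_of_lipschitz {H : E n → ℝ → E n → ℝ} {β K : ℝ} (hβ : 0 < β)
    (hK : 0 ≤ K) (hp : ∀ x t p q, |H x t p - H x t q| ≤ β * ‖p - q‖)
    (hx : ∀ x y t s p, |H x t p - H y s p| ≤ K * (‖x - y‖ + |t - s|) * ‖p‖)
    {u₀ : E n → ℝ} {u : E n × ℝ → ℝ} (hu : IsViscositySolution H u₀ u) :
    IsUniqueViscositySolution H u₀ u := by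
  refine ⟨hu, fun v hv z hz => le_antisymm ?_ ?_⟩
  · exact viscosity_comparison hβ hK hp hx hv.continuousOn hu.continuousOn
      (fun x => by rw [hv.initial, hu.initial]) hv.subsolution hu.supersolution z.1 z.2 hz.2
  · exact viscosity_comparison hβ hK hp hx hu.continuousOn hv.continuousOn
      (fun x => by rw [hv.initial, hu.initial]) hu.subsolution hv.supersolution z.1 z.2 hz.2

end StochHom

/-! ### Value functions of reachability relations are viscosity solutions -/

namespace StochHom

variable {n : ℕ}

theorem deriv_add_inner_gradient {φ : E n × ℝ → ℝ} {x : E n} {t : ℝ}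
    (hφ : DifferentiableAt ℝ φ (x, t)) (v : E n) (h : ℝ) :
    fderiv ℝ φ (x, t) (v, h) =
      h * deriv (fun s => φ (x, s)) t + inner ℝ (gradient (fun y => φ (y, t)) x) v := by
  have h1 : HasDerivAt (fun s => φ (x, s)) (fderiv ℝ φ (x, t) (0, 1)) t := by
    exact hφ.hasFDerivAt.comp_hasDerivAt t ((hasDerivAt_const t x).prodMk (hasDerivAt_id t))
  have h2 : HasFDerivAt (fun y => φ (y, t))
      ((fderiv ℝ φ (x, t)).comp (ContinuousLinearMap.inl ℝ (E n) ℝ)) x :=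
    HasFDerivAt.comp (g := φ) x (f := fun y => (y, t)) hφ.hasFDerivAt (hasFDerivAt_prodMk_left x t)
  rw [gradient, InnerProductSpace.toDual_symm_apply, h2.fderiv, h1.deriv]
  have h3 : ((v, h) : E n × ℝ) = (v, 0) + h • (0, 1) := by simp
  rw [h3, map_add, map_smul]
  simp only [ContinuousLinearMap.comp_apply, ContinuousLinearMap.inl_apply, smul_eq_mul]
  ring

/-- First order expansion of a test function along a backward cone. -/
theorem eventually_backward_expansion {φ : E n × ℝ → ℝ} {x : E n} {t : ℝ}
    (hφ : DifferentiableAt ℝ φ (x, t)) {S : Set (E n × ℝ)} (hS : S ∈ 𝓝 (x, t)) {B : ℝ}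
    (hB : 0 ≤ B) {η : ℝ} (hη : 0 < η) :
    ∀ᶠ h in 𝓝[>] (0 : ℝ), ∀ y : E n, ‖x - y‖ ≤ B * h → (y, t - h) ∈ S ∧
      |φ (x, t) - φ (y, t - h) - (h * deriv (fun s => φ (x, s)) t +
        inner ℝ (gradient (fun y => φ (y, t)) x) (x - y))| ≤ h * η := by
  have h1 := (hasFDerivAt_iff_isLittleO.1 hφ.hasFDerivAt).def
    (show 0 < η / (B + 1) by positivity)
  obtain ⟨r, hr0, hr⟩ := Metric.eventually_nhds_iff.1 (h1.and hS)
  have h2 : Ioo (0 : ℝ) (r / (B + 1)) ∈ 𝓝[>] (0 : ℝ) := Ioo_mem_nhdsGT (by positivity)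
  filter_upwards [h2] with h hh y hy
  have h3 : (B + 1) * h < r := by
    have := hh.2
    rw [lt_div_iff₀ (by positivity)] at this
    linarith
  have h4 : ‖(y, t - h) - (x, t)‖ ≤ (B + 1) * h := by
    have : 0 ≤ B * h := mul_nonneg hB hh.1.le
    have := hh.1
    rw [Prod.norm_def]
    refine max_le ?_ ?_
    · change ‖y - x‖ ≤ _
      rw [norm_sub_rev]
      linarith
    · change ‖t - h - t‖ ≤ _
      rw [Real.norm_eq_abs, sub_right_comm, sub_self, zero_sub, abs_neg, abs_of_pos this]
      linarith
  obtain ⟨h5, h6⟩ := hr (y := (y, t - h)) (by rw [dist_eq_norm]; linarith)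
  refine ⟨h6, ?_⟩
  have h7 : ((y, t - h) - (x, t) : E n × ℝ) = -(x - y, h) := by simp
  rw [h7, map_neg, deriv_add_inner_gradient hφ, ← h7] at h5
  rw [← abs_neg]
  calc _ = ‖φ (y, t - h) - φ (x, t) - -(h * deriv (fun s => φ (x, s)) t +
        inner ℝ (gradient (fun y => φ (y, t)) x) (x - y))‖ := by
        rw [Real.norm_eq_abs]; congr 1; ring
    _ ≤ η / (B + 1) * ((B + 1) * h) := h5.trans (by gcongr)
    _ = h * η := by field_simp

section Value

variable {Rel : E n → ℝ → E n → ℝ → Prop} {B : ℝ} {u₀ : E n → ℝ}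

/-- The smallest initial value among the points from which `z` can be reached. -/
noncomputable def valueFunction (Rel : E n → ℝ → E n → ℝ → Prop) (u₀ : E n → ℝ) (z : E n × ℝ) : ℝ :=
  sInf (u₀ '' {y | Rel y 0 z.1 z.2})

/-- Finite speed confines the starting points to a compact ball, so `u₀` is bounded below on them
and `sInf` is a genuine infimum. -/
theorem valueFunction_le
    (speed : ∀ {y x : E n} {s t : ℝ}, 0 ≤ s → s ≤ t → Rel y s x t → ‖x - y‖ ≤ B * (t - s))
    (hu₀ : Continuous u₀) {y x : E n} {t : ℝ} (ht : 0 ≤ t) (h : Rel y 0 x t) :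
    valueFunction Rel u₀ (x, t) ≤ u₀ y := by
  refine csInf_le ?_ ⟨y, h, rfl⟩
  refine ((isCompact_closedBall x (B * (t - 0))).bddBelow_image hu₀.continuousOn).mono ?_
  refine image_mono fun z hz => ?_
  rw [mem_closedBall_iff_norm']
  exact speed le_rfl ht hz

theorem exists_lt_of_valueFunction_lt {x : E n} {t : ℝ} (total : ∃ y, Rel y 0 x t) {c : ℝ}
    (hc : valueFunction Rel u₀ (x, t) < c) : ∃ y, Rel y 0 x t ∧ u₀ y < c := by
  obtain ⟨y, hy⟩ := total
  obtain ⟨-, ⟨z, hz, rfl⟩, h⟩ := exists_lt_of_csInf_lt (Set.Nonempty.image u₀ ⟨y, hy⟩) hc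
  exact ⟨z, hz, h⟩

/-- The value function of a reachability relation with infinitesimal generator `H` is a
viscosity solution. -/
theorem isViscositySolution_valueFunction {H : E n → ℝ → E n → ℝ} (hB : 0 ≤ B)
    (refl : ∀ x y : E n, Rel y 0 x 0 ↔ y = x)
    (trans : ∀ {y z x : E n} {s t : ℝ}, 0 ≤ s → s ≤ t → Rel y 0 z s → Rel z s x t → Rel y 0 x t)
    (split : ∀ {y x : E n} {s t : ℝ}, 0 ≤ s → s ≤ t → Rel y 0 x t →
      ∃ z, Rel y 0 z s ∧ Rel z s x t)
    (speed : ∀ {y x : E n} {s t : ℝ}, 0 ≤ s → s ≤ t → Rel y s x t → ‖x - y‖ ≤ B * (t - s))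
    (total : ∀ (x : E n) (t : ℝ), 0 ≤ t → ∃ y, Rel y 0 x t)
    (stab : ∀ (x : E n) (t : ℝ), 0 ≤ t → ∀ η > 0, ∀ᶠ z in 𝓝[univ ×ˢ Ici (0 : ℝ)] (x, t),
      (∀ y, Rel y 0 x t → ∃ y', Rel y' 0 z.1 z.2 ∧ ‖y - y'‖ < η) ∧
      ∀ y', Rel y' 0 z.1 z.2 → ∃ y, Rel y 0 x t ∧ ‖y' - y‖ < η)
    (lower : ∀ (x : E n) (t : ℝ), 0 < t → ∀ (p : E n), ∀ η > 0, ∀ᶠ h in 𝓝[>] (0 : ℝ),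
      ∃ y, Rel y (t - h) x t ∧ h * (H x t p - η) ≤ inner ℝ p (x - y))
    (upper : ∀ (x : E n) (t : ℝ), 0 < t → ∀ (p : E n), ∀ η > 0, ∀ᶠ h in 𝓝[>] (0 : ℝ),
      ∀ y, Rel y (t - h) x t → inner ℝ p (x - y) ≤ h * (H x t p + η))
    (hu₀ : UniformContinuous u₀) :
    IsViscositySolution H u₀ (valueFunction Rel u₀) where
  continuousOn := by
    rintro ⟨x, t⟩ ⟨-, ht⟩
    rw [ContinuousWithinAt, Metric.tendsto_nhds]
    intro ε hε
    obtain ⟨η, hη, hu⟩ := Metric.uniformContinuous_iff.1 hu₀ (ε / 2) (by positivity)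
    filter_upwards [stab x t ht η hη, self_mem_nhdsWithin] with z hz hz0
    rw [Real.dist_eq, abs_sub_lt_iff]
    constructor
    · obtain ⟨y, hy, hy2⟩ := exists_lt_of_valueFunction_lt (u₀ := u₀) (total x t ht)
        (lt_add_of_pos_right _ (show 0 < ε / 2 by positivity))
      obtain ⟨y', hy', hyy⟩ := hz.1 y hy
      have h1 := valueFunction_le speed hu₀.continuous hz0.2 hy'
      have h2 := hu (by rwa [dist_eq_norm] : dist y y' < η)
      rw [Real.dist_eq, abs_sub_lt_iff] at h2
      have h3 : valueFunction Rel u₀ z = valueFunction Rel u₀ (z.1, z.2) := rfl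
      linarith
    · obtain ⟨y, hy, hy2⟩ := exists_lt_of_valueFunction_lt (u₀ := u₀) (total z.1 z.2 hz0.2)
        (lt_add_of_pos_right _ (show 0 < ε / 2 by positivity))
      obtain ⟨y', hy', hyy⟩ := hz.2 y hy
      have h1 := valueFunction_le speed hu₀.continuous ht hy'
      have h2 := hu (by rwa [dist_eq_norm] : dist y y' < η)
      rw [Real.dist_eq, abs_sub_lt_iff] at h2
      have h3 : valueFunction Rel u₀ z = valueFunction Rel u₀ (z.1, z.2) := rfl
      linarith
  initial x := by simp [valueFunction, refl]
  subsolution φ hφ x t ht hmax := by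
    refine le_of_forall_pos_le_add fun ε hε => ?_
    rw [zero_add]
    have hd : DifferentiableAt ℝ φ (x, t) := hφ.differentiable one_ne_zero _
    have h0 : Ioo (0 : ℝ) t ∈ 𝓝[>] (0 : ℝ) := Ioo_mem_nhdsGT ht
    obtain ⟨h, h1, h2, ⟨y, hy, h3⟩⟩ := ((eventually_backward_expansion hd hmax hB
      (half_pos hε)).and ((eventually_mem_set.2 h0).and
        (lower x t ht (gradient (fun y => φ (y, t)) x) (ε / 2) (half_pos hε)))).exists
    have ht' : 0 ≤ t - h := by linarith [h2.2]
    have hsp := speed ht' (by linarith [h2.1]) hy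
    rw [sub_sub_cancel] at hsp
    obtain ⟨h4, h5⟩ := h1 y hsp
    -- Dynamic programming, easy half: whatever reaches `(y, t - h)` also reaches `(x, t)`.
    have h6 : valueFunction Rel u₀ (x, t) ≤ valueFunction Rel u₀ (y, t - h) := by
      refine le_of_forall_pos_lt_add fun c hc => ?_
      obtain ⟨y₀, hy₀, hlt⟩ := exists_lt_of_valueFunction_lt (u₀ := u₀) (total y (t - h) ht')
        (lt_add_of_pos_right _ hc)
      exact (valueFunction_le speed hu₀.continuous ht.le
        (trans ht' (by linarith [h2.1]) hy₀ hy)).trans_lt hlt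
    have h7 : valueFunction Rel u₀ (y, t - h) - φ (y, t - h) ≤
      valueFunction Rel u₀ (x, t) - φ (x, t) := h4
    have h8 := abs_le.1 h5
    refine le_of_mul_le_mul_left ?_ h2.1
    linarith
  supersolution φ hφ x t ht hmin := by
    refine le_of_forall_pos_le_add fun ε hε => ?_
    have hd : DifferentiableAt ℝ φ (x, t) := hφ.differentiable one_ne_zero _
    have h0 : Ioo (0 : ℝ) t ∈ 𝓝[>] (0 : ℝ) := Ioo_mem_nhdsGT ht
    have hε3 : 0 < ε / 3 := by positivity
    obtain ⟨h, h1, h2, h3⟩ := ((eventually_backward_expansion hd hmin hB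
      hε3).and ((eventually_mem_set.2 h0).and
        (upper x t ht (gradient (fun y => φ (y, t)) x) (ε / 3) hε3))).exists
    have ht' : 0 ≤ t - h := by linarith [h2.2]
    -- Optimality up to `h * (ε / 3)`: the defect has to survive division by `h`.
    obtain ⟨y₀, hy₀, hlt⟩ := exists_lt_of_valueFunction_lt (u₀ := u₀) (total x t ht.le)
      (lt_add_of_pos_right _ (mul_pos h2.1 hε3))
    obtain ⟨y, hy1, hy⟩ := split ht' (by linarith [h2.1]) hy₀
    have hsp := speed ht' (by linarith [h2.1]) hy
    rw [sub_sub_cancel] at hsp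
    obtain ⟨h4, h5⟩ := h1 y hsp
    have h6 := valueFunction_le speed hu₀.continuous ht' hy1
    have h7 : valueFunction Rel u₀ (x, t) - φ (x, t) ≤
      valueFunction Rel u₀ (y, t - h) - φ (y, t - h) := h4
    have h8 := abs_le.1 h5
    have h9 := h3 y hy
    refine le_of_mul_le_mul_left ?_ h2.1
    linarith

end Value

end StochHom

/-! ### Admissible paths and the reachability relation -/

namespace StochHom

variable {n : ℕ}

/-- Bounded, positive, Lipschitz velocities. -/
structure IsSpeed (c : E n → ℝ → ℝ) (α β K : ℝ) : Prop where
  pos : 0 < α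
  lower : ∀ x t, α ≤ c x t
  upper : ∀ x t, c x t ≤ β
  nonneg : 0 ≤ K
  lip : ∀ x y t s, |c x t - c y s| ≤ K * (‖x - y‖ + |t - s|)

theorem IsSpeed.beta_pos {c : E n → ℝ → ℝ} {α β K : ℝ} (hc : IsSpeed c α β K) : 0 < β :=
  hc.pos.trans_le ((hc.lower 0 0).trans (hc.upper 0 0))

theorem IsSpeed.speed_nonneg {c : E n → ℝ → ℝ} {α β K : ℝ} (hc : IsSpeed c α β K) (x : E n)
    (t : ℝ) : 0 ≤ c x t :=
  hc.pos.le.trans (hc.lower x t)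

/-- Integrated form of the constraint on the speed of a path. -/
def IsSpeedPath (c : E n → ℝ → ℝ) (s t : ℝ) (γ : ℝ → E n) : Prop :=
  ∀ r₁ r₂, s ≤ r₁ → r₁ ≤ r₂ → r₂ ≤ t → ∀ M, (∀ r ∈ Icc r₁ r₂, c (γ r) r ≤ M) →
    ‖γ r₂ - γ r₁‖ ≤ M * (r₂ - r₁)

theorem absolutelyContinuousOnInterval_inner {γ : ℝ → E n} {s t : ℝ}
    (h : AbsolutelyContinuousOnInterval γ s t) (v : E n) :
    AbsolutelyContinuousOnInterval (fun r => inner ℝ v (γ r)) s t := by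
  have h1 : Tendsto (fun E : ℕ × (ℕ → ℝ × ℝ) => ‖v‖ *
      ∑ i ∈ Finset.range E.1, dist (γ (E.2 i).1) (γ (E.2 i).2))
      (AbsolutelyContinuousOnInterval.totalLengthFilter ⊓
        𝓟 (AbsolutelyContinuousOnInterval.disjWithin s t)) (𝓝 (‖v‖ * 0)) :=
    Filter.Tendsto.const_mul ‖v‖ h
  rw [mul_zero] at h1
  refine squeeze_zero (fun E => Finset.sum_nonneg fun i _ => dist_nonneg) (fun E => ?_) h1
  rw [Finset.mul_sum]
  refine Finset.sum_le_sum fun i _ => ?_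
  rw [Real.dist_eq, ← inner_sub_right, dist_eq_norm]
  exact abs_real_inner_le_norm _ _

/-- Pair `γ` with its increment `v = γ r₂ - γ r₁`. This scalar function is absolutely continuous
with derivative at most `‖v‖ * M`, and its total increment is `‖v‖ ^ 2`. -/
theorem IsAdmissiblePath.isSpeedPath {c : E n → ℝ → ℝ} (hc : ∀ x t, 0 ≤ c x t) {s t : ℝ}
    {γ : ℝ → E n} (h : IsAdmissiblePath c s t γ) : IsSpeedPath c s t γ := by
  intro r₁ r₂ h1 h12 h2 M hM
  have hM0 : 0 ≤ M := (hc _ _).trans (hM r₁ (left_mem_Icc.2 h12))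
  set v := γ r₂ - γ r₁ with hv
  have hsub : Icc r₁ r₂ ⊆ Icc s t := Icc_subset_Icc h1 h2
  have hac : AbsolutelyContinuousOnInterval (fun r => inner ℝ v (γ r)) r₁ r₂ := by
    refine (absolutelyContinuousOnInterval_inner h.1 v).mono ?_
    rwa [uIcc_of_le h12, uIcc_of_le (h1.trans (h12.trans h2))]
  have hint := hac.integral_deriv_eq_sub
  have hae : ∀ᵐ r ∂volume.restrict (Icc r₁ r₂), deriv (fun r => inner ℝ v (γ r)) r ≤ ‖v‖ * M := by
    have h3 := ae_mono (Measure.restrict_mono hsub le_rfl) h.2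
    filter_upwards [h3, ae_restrict_mem measurableSet_Icc] with r ⟨w, hw, hwc⟩ hr
    have h4 : HasDerivAt (fun r => inner ℝ v (γ r)) (inner ℝ v w) r := by
      have := (hasDerivAt_const r v).inner ℝ hw
      simpa using this
    rw [h4.deriv]
    refine (real_inner_le_norm _ _).trans ?_
    gcongr
    exact hwc.trans (hM r hr)
  have h5 := intervalIntegral.integral_mono_ae_restrict h12 hac.intervalIntegrable_deriv
    intervalIntegrable_const hae
  rw [hint, ← inner_sub_right, ← hv, real_inner_self_eq_norm_sq, intervalIntegral.integral_const,
    smul_eq_mul] at h5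
  rcases (norm_nonneg v).eq_or_lt with h6 | h6
  · rw [← h6]
    exact mul_nonneg hM0 (sub_nonneg.2 h12)
  · refine le_of_mul_le_mul_left ?_ h6
    linarith

theorem IsSpeedPath.norm_sub_le {c : E n → ℝ → ℝ} {α β K : ℝ} (hc : IsSpeed c α β K) {s t : ℝ}
    {γ : ℝ → E n} (h : IsSpeedPath c s t γ) {r₁ r₂ : ℝ} (h1 : s ≤ r₁) (h12 : r₁ ≤ r₂)
    (h2 : r₂ ≤ t) : ‖γ r₂ - γ r₁‖ ≤ β * (r₂ - r₁) :=
  h r₁ r₂ h1 h12 h2 β fun _ _ => hc.upper _ _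

/-- During a time `h` the path moves by at most `β * h`, so along it `c` varies by at most `K * (β +
1) * h`. -/
theorem IsSpeedPath.norm_sub_le_lip {c : E n → ℝ → ℝ} {α β K : ℝ} (hc : IsSpeed c α β K) {s t : ℝ}
    {γ : ℝ → E n} (h : IsSpeedPath c s t γ) {r₁ r₂ r : ℝ} (h1 : s ≤ r₁) (h12 : r₁ ≤ r₂)
    (h2 : r₂ ≤ t) (hr : r ∈ Icc r₁ r₂) :
    ‖γ r₂ - γ r₁‖ ≤ (c (γ r) r + K * ((β + 1) * (r₂ - r₁))) * (r₂ - r₁) := by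
  refine h r₁ r₂ h1 h12 h2 _ fun q hq => ?_
  have h3 : ‖γ q - γ r‖ ≤ β * (r₂ - r₁) := by
    rcases le_total q r with h | h
    · rw [norm_sub_rev]
      refine (IsSpeedPath.norm_sub_le hc ‹_› (h1.trans hq.1) h (hr.2.trans h2)).trans ?_
      have := hc.beta_pos
      gcongr
      · exact hr.2
      · exact hq.1
    · refine (IsSpeedPath.norm_sub_le hc ‹_› (h1.trans hr.1) h (hq.2.trans h2)).trans ?_
      have := hc.beta_pos
      gcongr
      · exact hq.2
      · exact hr.1
  have h4 : |q - r| ≤ r₂ - r₁ := abs_sub_le_of_le_of_le hq.1 hq.2 hr.1 hr.2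
  have h5 := (abs_le.1 (hc.lip (γ q) (γ r) q r)).2
  have h6 : K * (‖γ q - γ r‖ + |q - r|) ≤ K * ((β + 1) * (r₂ - r₁)) :=
    mul_le_mul_of_nonneg_left (by linarith) hc.nonneg
  linarith

/-- The path is Lipschitz, hence differentiable almost everywhere; on short intervals around `r` its
Lipschitz constant is close to `c (γ r) r`, which bounds the derivative there. -/
theorem IsSpeedPath.isAdmissiblePath {c : E n → ℝ → ℝ} {α β K : ℝ} (hc : IsSpeed c α β K)
    {s t : ℝ} (hst : s ≤ t) {γ : ℝ → E n} (h : IsSpeedPath c s t γ) :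
    IsAdmissiblePath c s t γ := by
  have hlip : LipschitzOnWith ⟨β, hc.beta_pos.le⟩ γ (Icc s t) := by
    refine LipschitzOnWith.of_dist_le_mul fun x hx y hy => ?_
    rw [dist_eq_norm, Real.dist_eq]
    change _ ≤ β * |x - y|
    rcases le_total x y with hxy | hxy
    · rw [norm_sub_rev, abs_sub_comm, abs_of_nonneg (sub_nonneg.2 hxy)]
      exact h.norm_sub_le hc hx.1 hxy hy.2
    · rw [abs_of_nonneg (sub_nonneg.2 hxy)]
      exact h.norm_sub_le hc hy.1 hxy hx.2
  refine ⟨LipschitzOnWith.absolutelyContinuousOnInterval (by rwa [uIcc_of_le hst]), ?_⟩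
  rw [Measure.restrict_congr_set Ioo_ae_eq_Icc.symm]
  have h1 := (hlip.mono Ioo_subset_Icc_self).ae_differentiableWithinAt_real measurableSet_Ioo
  filter_upwards [h1, ae_restrict_mem measurableSet_Ioo] with r hr hrI
  have hnhds : Ioo s t ∈ 𝓝 r := isOpen_Ioo.mem_nhds hrI
  have hd := (hr.differentiableAt hnhds).hasDerivAt
  refine ⟨_, hd, le_of_forall_pos_le_add fun ε hε => ?_⟩
  refine hd.le_of_lip' (by have := hc.speed_nonneg (γ r) r; linarith) ?_
  have h2 : ∀ᶠ q in 𝓝 r, K * ((β + 1) * |q - r|) < ε := by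
    have : Continuous fun q => K * ((β + 1) * |q - r|) := by fun_prop
    exact this.continuousAt.eventually (gt_mem_nhds (by simpa using hε))
  filter_upwards [h2, hnhds] with q hq hqI
  rw [Real.norm_eq_abs]
  rcases le_total q r with hqr | hqr
  · have := h.norm_sub_le_lip hc hqI.1.le hqr hrI.2.le (right_mem_Icc.2 hqr)
    rw [abs_sub_comm, abs_of_nonneg (sub_nonneg.2 hqr)] at hq ⊢
    rw [norm_sub_rev]
    refine this.trans ?_
    gcongr
  · have := h.norm_sub_le_lip hc hrI.1.le hqr hqI.2.le (left_mem_Icc.2 hqr)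
    rw [abs_of_nonneg (sub_nonneg.2 hqr)] at hq ⊢
    refine this.trans ?_
    gcongr

/-- The point `x` at time `t` can be reached from the point `y` at time `s`. -/
def Reach (c : E n → ℝ → ℝ) (y : E n) (s : ℝ) (x : E n) (t : ℝ) : Prop :=
  ∃ γ, IsSpeedPath c s t γ ∧ γ s = y ∧ γ t = x

/-- Passing to the integrated constraint removes derivatives, so that gluing, cutting, reversing,
translating and rescaling paths become elementary. -/
theorem mem_reachableSet_iff {c : E n → ℝ → ℝ} {α β K : ℝ} (hc : IsSpeed c α β K) {t : ℝ}
    (ht : 0 ≤ t) {x y : E n} : y ∈ reachableSet c t x ↔ Reach c x 0 y t :=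
  ⟨fun ⟨γ, h, h1⟩ => ⟨γ, h.isSpeedPath hc.speed_nonneg, h1⟩,
    fun ⟨γ, h, h1⟩ => ⟨γ, h.isAdmissiblePath hc ht, h1⟩⟩

namespace Reach

variable {c : E n → ℝ → ℝ} {α β K s t r : ℝ} {x y z : E n}

theorem refl_iff : Reach c y s x s ↔ y = x := by
  refine ⟨fun ⟨γ, _, h1, h2⟩ => h1.symm.trans h2, fun h => ⟨fun _ => y, ?_, rfl, h⟩⟩
  intro r₁ r₂ h1 h12 h2 M hM
  rw [le_antisymm h12 (h2.trans h1)]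
  simp

theorem trans (h1 : s ≤ r) (h2 : r ≤ t) (hyz : Reach c y s z r) (hzx : Reach c z r x t) :
    Reach c y s x t := by
  obtain ⟨γ₁, hγ₁, hs₁, ht₁⟩ := hyz
  obtain ⟨γ₂, hγ₂, hs₂, ht₂⟩ := hzx
  set γ : ℝ → E n := fun q => if q ≤ r then γ₁ q else γ₂ q
  have e1 : ∀ q ≤ r, γ q = γ₁ q := fun q hq => if_pos hq
  have e2 : ∀ q, r ≤ q → γ q = γ₂ q := fun q hq => by
    rcases hq.eq_or_lt with h | h
    · rw [← h, e1 r le_rfl, ht₁, hs₂]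
    · exact if_neg (not_le.2 h)
  have k1 : ∀ r₁ r₂, s ≤ r₁ → r₁ ≤ r₂ → r₂ ≤ r → ∀ M, (∀ q ∈ Icc r₁ r₂, c (γ q) q ≤ M) →
      ‖γ r₂ - γ r₁‖ ≤ M * (r₂ - r₁) := fun r₁ r₂ a1 a2 a3 M hM => by
    rw [e1 r₂ a3, e1 r₁ (a2.trans a3)]
    refine hγ₁ r₁ r₂ a1 a2 a3 M fun q hq => ?_
    rw [← e1 q (hq.2.trans a3)]
    exact hM q hq
  have k2 : ∀ r₁ r₂, r ≤ r₁ → r₁ ≤ r₂ → r₂ ≤ t → ∀ M, (∀ q ∈ Icc r₁ r₂, c (γ q) q ≤ M) →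
      ‖γ r₂ - γ r₁‖ ≤ M * (r₂ - r₁) := fun r₁ r₂ a1 a2 a3 M hM => by
    rw [e2 r₂ (a1.trans a2), e2 r₁ a1]
    refine hγ₂ r₁ r₂ a1 a2 a3 M fun q hq => ?_
    rw [← e2 q (a1.trans hq.1)]
    exact hM q hq
  refine ⟨γ, fun r₁ r₂ a1 a2 a3 M hM => ?_, (e1 s h1).trans hs₁, (e2 t h2).trans ht₂⟩
  rcases le_total r₂ r with h | h
  · exact k1 r₁ r₂ a1 a2 h M hM
  rcases le_total r r₁ with h' | h'
  · exact k2 r₁ r₂ h' a2 a3 M hM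
  have m1 := k1 r₁ r a1 h' le_rfl M fun q hq => hM q ⟨hq.1, hq.2.trans h⟩
  have m2 := k2 r r₂ le_rfl h a3 M fun q hq => hM q ⟨h'.trans hq.1, hq.2⟩
  have m3 := norm_sub_le_norm_sub_add_norm_sub (γ r₂) (γ r) (γ r₁)
  linarith

theorem split (h1 : s ≤ r) (h2 : r ≤ t) (h : Reach c y s x t) :
    ∃ z, Reach c y s z r ∧ Reach c z r x t := by
  obtain ⟨γ, hγ, hs, ht⟩ := h
  exact ⟨γ r, ⟨γ, fun r₁ r₂ a1 a2 a3 => hγ r₁ r₂ a1 a2 (a3.trans h2), hs, rfl⟩,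
    ⟨γ, fun r₁ r₂ a1 a2 a3 => hγ r₁ r₂ (h1.trans a1) a2 a3, rfl, ht⟩⟩

theorem norm_sub_le (hc : IsSpeed c α β K) (hst : s ≤ t) (h : Reach c y s x t) :
    ‖x - y‖ ≤ β * (t - s) := by
  obtain ⟨γ, hγ, rfl, rfl⟩ := h
  exact hγ.norm_sub_le hc le_rfl hst le_rfl

theorem norm_sub_le_lip (hc : IsSpeed c α β K) (hst : s ≤ t) (h : Reach c y s x t) :
    ‖x - y‖ ≤ (c x t + K * ((β + 1) * (t - s))) * (t - s) := by
  obtain ⟨γ, hγ, rfl, rfl⟩ := h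
  exact hγ.norm_sub_le_lip hc le_rfl hst le_rfl (right_mem_Icc.2 hst)

/-- Used to turn stability in the starting point into stability in the end point. -/
theorem rev_aux (h : Reach c y s x t) : Reach (fun x r => c x (-r)) x (-t) y (-s) := by
  obtain ⟨γ, hγ, hs, ht⟩ := h
  refine ⟨fun r => γ (-r), fun r₁ r₂ a1 a2 a3 M hM => ?_, by simpa using ht, by simpa using hs⟩
  have := hγ (-r₂) (-r₁) (by linarith) (by linarith) (by linarith) M fun r hr => by
    have := hM (-r) ⟨by linarith [hr.2], by linarith [hr.1]⟩
    simpa using this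
  rw [norm_sub_rev] at this
  convert this using 2
  ring

theorem rev_iff : Reach (fun x r => c x (-r)) x (-t) y (-s) ↔ Reach c y s x t :=
  ⟨fun h => by simpa using h.rev_aux, rev_aux⟩

theorem add_vec {l : E n} (hl : ∀ x t, c (x + l) t = c x t) (h : Reach c y s x t) :
    Reach c (y + l) s (x + l) t := by
  obtain ⟨γ, hγ, rfl, rfl⟩ := h
  refine ⟨fun r => γ r + l, fun r₁ r₂ a1 a2 a3 M hM => ?_, rfl, rfl⟩
  rw [add_sub_add_right_eq_sub]
  exact hγ r₁ r₂ a1 a2 a3 M fun r hr => by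
    rw [← hl]
    exact hM r hr

theorem shift_aux (k : ℝ) (h : Reach c y s x t) :
    Reach (fun x r => c x (r + k)) y (s - k) x (t - k) := by
  obtain ⟨γ, hγ, hs, ht⟩ := h
  refine ⟨fun r => γ (r + k), fun r₁ r₂ a1 a2 a3 M hM => ?_, by simpa using hs, by simpa using ht⟩
  have := hγ (r₁ + k) (r₂ + k) (by linarith) (by linarith) (by linarith) M fun r hr => by
    have := hM (r - k) ⟨by linarith [hr.1], by linarith [hr.2]⟩
    simpa using this
  rwa [add_sub_add_right_eq_sub] at this

theorem shift_iff (k : ℝ) :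
    Reach (fun x r => c x (r + k)) y s x t ↔ Reach c y (s + k) x (t + k) :=
  ⟨fun h => by simpa using h.shift_aux (-k), fun h => by simpa using h.shift_aux k⟩

end Reach

/-- The straight segment from `(y,s)` to `(x,t)` is admissible. -/
def IsSegment (c : E n → ℝ → ℝ) (y : E n) (s : ℝ) (x : E n) (t : ℝ) : Prop :=
  ∀ θ ∈ Icc (0 : ℝ) 1, ‖x - y‖ ≤ c (y + θ • (x - y)) (s + θ * (t - s)) * (t - s)

theorem IsSegment.reach {c : E n → ℝ → ℝ} {y x : E n} {s t : ℝ} (hst : s ≤ t)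
    (h : IsSegment c y s x t) : Reach c y s x t := by
  rcases hst.eq_or_lt with rfl | hst
  · have := h 0 (by simp)
    rw [Reach.refl_iff, eq_comm, ← sub_eq_zero, ← norm_le_zero_iff]
    simpa using this
  have hts : 0 < t - s := sub_pos.2 hst
  refine ⟨fun r => y + ((r - s) / (t - s)) • (x - y), fun r₁ r₂ a1 a2 a3 M hM => ?_, by simp, ?_⟩
  · have e1 : (y + ((r₂ - s) / (t - s)) • (x - y)) - (y + ((r₁ - s) / (t - s)) • (x - y)) =
        ((r₂ - r₁) / (t - s)) • (x - y) := by
      rw [add_sub_add_left_eq_sub, ← sub_smul]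
      congr 1
      field_simp
      ring
    simp only [e1]
    rw [norm_smul, Real.norm_eq_abs, abs_of_nonneg (div_nonneg (sub_nonneg.2 a2) hts.le)]
    have h1 := h ((r₁ - s) / (t - s)) ⟨div_nonneg (by linarith) hts.le,
      (div_le_one hts).2 (by linarith)⟩
    have h2 : s + (r₁ - s) / (t - s) * (t - s) = r₁ := by field_simp; ring
    rw [h2] at h1
    have h3 := hM r₁ (left_mem_Icc.2 a2)
    have h4 : ‖x - y‖ ≤ M * (t - s) := h1.trans (by gcongr)
    have h5 : 0 ≤ r₂ - r₁ := sub_nonneg.2 a2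
    calc _ ≤ (r₂ - r₁) / (t - s) * (M * (t - s)) := by gcongr
      _ = _ := by field_simp
  · simp [div_self hts.ne']

theorem Reach.of_norm_le {c : E n → ℝ → ℝ} {α β K : ℝ} (hc : IsSpeed c α β K) {y x : E n}
    {s t : ℝ} (hst : s ≤ t) (h : ‖x - y‖ ≤ α * (t - s)) : Reach c y s x t :=
  IsSegment.reach hst fun θ _ => h.trans (by
    have := hc.lower (y + θ • (x - y)) (s + θ * (t - s))
    have := sub_nonneg.2 hst
    gcongr)

theorem Reach.const {c : E n → ℝ → ℝ} {α β K : ℝ} (hc : IsSpeed c α β K) (x : E n)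
    {s t : ℝ} (hst : s ≤ t) : Reach c x s x t :=
  Reach.of_norm_le hc hst (by
    have := hc.pos
    have := sub_nonneg.2 hst
    simp only [sub_self, norm_zero]
    positivity)

theorem IsSpeed.rev {c : E n → ℝ → ℝ} {α β K : ℝ} (hc : IsSpeed c α β K) :
    IsSpeed (fun x r => c x (-r)) α β K where
  pos := hc.pos
  lower x t := hc.lower x _
  upper x t := hc.upper x _
  nonneg := hc.nonneg
  lip x y t s := by
    have := hc.lip x y (-t) (-s)
    rwa [neg_sub_neg, abs_sub_comm s t] at this

end StochHom

/-! ### Polygonal approximation and stability of reachable points -/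

namespace StochHom

variable {n : ℕ} {c : E n → ℝ → ℝ} {α β K : ℝ}

/-- One step of an Euler scheme that follows a given increment `g' - g` at reduced speed, with
nodes in a dense set. -/
theorem exists_segment_near (hc : IsSpeed c α β K) {Q : Set (E n)} (hQ : Dense Q)
    {y g g' : E n} {s h ρ S : ℝ} (hh : 0 < h) (hρ : 0 < ρ) (hρ1 : ρ ≤ 1)
    (hg : ‖g' - g‖ ≤ (c g s + K * ((β + 1) * h)) * h) (hgβ : ‖g' - g‖ ≤ β * h)
    (hS : S = ρ + 2 * (K * ((β + 2) * h))) (hsmall : K * ‖y - g‖ + S ≤ α) :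
    ∃ y' ∈ Q, IsSegment c y s y' (s + h) ∧
      ‖y' - g'‖ + S ≤ (‖y - g‖ + S) * (1 + (K + 1) * (β / α + 1) * h) := by
  have hα := hc.pos
  have hβ := hc.beta_pos
  have hK := hc.nonneg
  set e := ‖y - g‖ with he
  have he0 : 0 ≤ e := norm_nonneg _
  -- The increment is slowed by the factor `1 - κ`. The speed gained, at least `κ * α = K * e + S`,
  -- pays for evaluating `c` away from `g`, for its variation during the step, and for moving the
  -- node into `Q`.
  set κ := (K * e + S) / α with hκ
  have hρS : ρ ≤ S := by
    rw [hS]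
    exact le_add_of_nonneg_right (by positivity)
  have hκ0 : 0 ≤ κ := div_nonneg (by nlinarith) hα.le
  have hκ1 : κ ≤ 1 := (div_le_one hα).2 hsmall
  have hκα : κ * α = K * e + S := by simp only [hκ]; field_simp
  obtain ⟨y', hy'Q, hy'⟩ := hQ.exists_dist_lt (y + (1 - κ) • (g' - g)) (mul_pos hρ hh)
  rw [dist_comm, dist_eq_norm] at hy'
  have h1 : ‖y' - y‖ ≤ (1 - κ) * ‖g' - g‖ + ρ * h := by
    have h2 : y' - y = (1 - κ) • (g' - g) + (y' - (y + (1 - κ) • (g' - g))) := by abel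
    rw [h2]
    refine (norm_add_le _ _).trans ?_
    rw [norm_smul, Real.norm_eq_abs, abs_of_nonneg (sub_nonneg.2 hκ1)]
    linarith
  have h2 : ‖y' - y‖ ≤ (β + 1) * h := by
    have : (1 - κ) * ‖g' - g‖ ≤ 1 * ‖g' - g‖ := by gcongr; linarith
    nlinarith
  refine ⟨y', hy'Q, fun θ hθ => ?_, ?_⟩
  · rw [add_sub_cancel_left]
    have h3 : ‖y + θ • (y' - y) - g‖ ≤ e + (β + 1) * h := by
      have : y + θ • (y' - y) - g = (y - g) + θ • (y' - y) := by abel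
      rw [this]
      refine (norm_add_le _ _).trans ?_
      rw [norm_smul, Real.norm_eq_abs, abs_of_nonneg hθ.1]
      have : θ * ‖y' - y‖ ≤ 1 * ‖y' - y‖ := by gcongr; exact hθ.2
      linarith
    have h4 : |s + θ * h - s| ≤ h := by
      rw [add_sub_cancel_left, abs_of_nonneg (mul_nonneg hθ.1 hh.le)]
      have : θ * h ≤ 1 * h := by gcongr; exact hθ.2
      linarith
    have h5 := (abs_le.1 (hc.lip (y + θ • (y' - y)) g (s + θ * h) s)).1
    have h6 : K * (‖y + θ • (y' - y) - g‖ + |s + θ * h - s|) ≤ K * (e + (β + 2) * h) :=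
      mul_le_mul_of_nonneg_left (by linarith) hK
    have h7 : (1 - κ) * ‖g' - g‖ ≤ (1 - κ) * ((c g s + K * ((β + 1) * h)) * h) :=
      mul_le_mul_of_nonneg_left hg (by linarith)
    have h8 : (1 - κ) * (c g s + K * ((β + 1) * h)) ≤ c g s - κ * α + K * ((β + 2) * h) := by
      have a1 : κ * α ≤ κ * c g s := mul_le_mul_of_nonneg_left (hc.lower _ _) hκ0
      have a2 : 0 ≤ κ * (K * ((β + 1) * h)) := by positivity
      have a3 : 0 ≤ K * h := by positivity
      linarith
    have h9 : (1 - κ) * (c g s + K * ((β + 1) * h)) + ρ ≤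
        c (y + θ • (y' - y)) (s + θ * h) := by linarith
    calc _ ≤ ((1 - κ) * (c g s + K * ((β + 1) * h)) + ρ) * h := by linarith
      _ ≤ _ := by gcongr
  -- The new error is at most `e` plus `ρ * h` for rounding plus `κ * (β * h)` for the lost speed.
  -- Both additions are multiples of `(e + S) * h`, so carrying `S` along makes the recursion purely
  -- multiplicative.
  · have h3 : ‖y' - g'‖ ≤ ρ * h + e + κ * (β * h) := by
      have : y' - g' = (y' - (y + (1 - κ) • (g' - g))) + (y - g) - κ • (g' - g) := by
        rw [sub_smul, one_smul]
        abel
      rw [this]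
      refine (norm_sub_le _ _).trans ?_
      rw [norm_smul, Real.norm_eq_abs, abs_of_nonneg hκ0]
      have := norm_add_le (y' - (y + (1 - κ) • (g' - g))) (y - g)
      have : κ * ‖g' - g‖ ≤ κ * (β * h) := by gcongr
      linarith
    have h4 : κ * (β * h) ≤ (K + 1) * (e + S) * (β / α) * h := by
      have : κ * (β * h) = (K * e + S) * (β / α) * h := by simp only [hκ]; field_simp
      rw [this]
      have : K * e + S ≤ (K + 1) * (e + S) := by nlinarith
      gcongr
    have h5 : ρ * h ≤ (K + 1) * (e + S) * h := by
      have : ρ ≤ (K + 1) * (e + S) := by nlinarith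
      gcongr
    linarith

/-- Points reached from `y` at time `s` by `m` admissible segments of duration `h` whose
intermediate nodes lie in `Q`. -/
def ChainReach (c : E n → ℝ → ℝ) (Q : Set (E n)) (y : E n) (s h : ℝ) : ℕ → E n → Prop
  | 0, x => x = y
  | m + 1, x => ∃ z ∈ insert y Q, ChainReach c Q y s h m z ∧
      IsSegment c z (s + m * h) x (s + m * h + h)

theorem ChainReach.reach {Q : Set (E n)} {y : E n} {s h : ℝ} (hh : 0 ≤ h) {m : ℕ} {x : E n}
    (H : ChainReach c Q y s h m x) : Reach c y s x (s + m * h) := by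
  induction m generalizing x with
  | zero =>
    have : x = y := H
    simp [Reach.refl_iff, this]
  | succ m ih =>
    obtain ⟨z, -, hz, hzx⟩ := H
    have h1 : s + (m + 1 : ℕ) * h = s + m * h + h := by push_cast; ring
    rw [h1]
    exact (ih hz).trans (le_add_of_nonneg_right (by positivity)) (by linarith)
      (hzx.reach (by linarith))

theorem ChainReach.reach_div (hc : IsSpeed c α β K)
    {Q : Set (E n)} {y x : E n} {s t : ℝ} (hst : s ≤ t) {m : ℕ}
    (h : ChainReach c Q y s ((t - s) / m) m x) : Reach c y s x t := by
  rcases Nat.eq_zero_or_pos m with rfl | hm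
  · have : x = y := h
    rw [this]
    exact Reach.const hc _ hst
  · have hm0 : (m : ℝ) ≠ 0 := by positivity
    have h4 := h.reach (div_nonneg (sub_nonneg.2 hst) (Nat.cast_nonneg m))
    rwa [mul_div_cancel₀ _ hm0, add_sub_cancel] at h4

/-- A discrete Gronwall argument: the one-step growth factors multiply to at most the exponential.
`hsmall` keeps the slowdown factor in `[0,1]` at every step. -/
theorem IsSpeedPath.exists_chainReach (hc : IsSpeed c α β K) {Q : Set (E n)} (hQ : Dense Q)
    {γ : ℝ → E n} {s t h ρ S : ℝ} (hγ : IsSpeedPath c s t γ) (hh : 0 < h) (hρ : 0 < ρ)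
    (hρ1 : ρ ≤ 1) (hS : S = ρ + 2 * (K * ((β + 2) * h))) {y : E n} {m : ℕ}
    (hm : s + m * h = t)
    (hsmall : (K + 1) * ((‖y - γ s‖ + S) * Real.exp ((K + 1) * (β / α + 1) * (t - s))) ≤ α) :
    ∃ x ∈ insert y Q, ChainReach c Q y s h m x ∧
      ‖x - γ t‖ + S ≤ (‖y - γ s‖ + S) * Real.exp ((K + 1) * (β / α + 1) * (t - s)) := by
  have hα := hc.pos
  have hβ := hc.beta_pos
  have hK := hc.nonneg
  set A := (K + 1) * (β / α + 1) with hA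
  have hA0 : 0 ≤ A := by positivity
  have hS0 : 0 ≤ S := by rw [hS]; positivity
  have key : ∀ i ≤ m, ∃ x ∈ insert y Q, ChainReach c Q y s h i x ∧
      ‖x - γ (s + i * h)‖ + S ≤ (‖y - γ s‖ + S) * (1 + A * h) ^ i := by
    intro i
    induction i with
    | zero => exact fun _ => ⟨y, mem_insert _ _, rfl, by simp⟩
    | succ i ih =>
      intro hi
      obtain ⟨x, hx, hxc, hxe⟩ := ih (by omega)
      have hpow : (1 + A * h) ^ i ≤ Real.exp (A * (t - s)) := by
        calc (1 + A * h) ^ i ≤ Real.exp (A * h) ^ i := by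
              gcongr
              linarith [Real.add_one_le_exp (A * h)]
          _ = Real.exp (A * (i * h)) := by rw [← Real.exp_nat_mul]; ring_nf
          _ ≤ _ := by
            gcongr
            have : (i : ℝ) ≤ m := by exact_mod_cast (by omega : i ≤ m)
            have : (i : ℝ) * h ≤ m * h := by gcongr
            linarith
      have e1 : s + (i + 1 : ℕ) * h = s + i * h + h := by push_cast; ring
      have e2 : s ≤ s + i * h := le_add_of_nonneg_right (by positivity)
      have e3 : s + i * h ≤ s + i * h + h := by linarith
      have e4 : s + i * h + h ≤ t := by
        have : ((i + 1 : ℕ) : ℝ) ≤ m := by exact_mod_cast hi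
        have : ((i + 1 : ℕ) : ℝ) * h ≤ m * h := by gcongr
        linarith
      have e5 := hγ.norm_sub_le hc e2 e3 e4
      have e6 := hγ.norm_sub_le_lip hc e2 e3 e4 (left_mem_Icc.2 e3)
      rw [add_sub_cancel_left] at e5 e6
      have e7 : ‖x - γ (s + i * h)‖ + S ≤ (‖y - γ s‖ + S) * Real.exp (A * (t - s)) :=
        hxe.trans (by gcongr)
      have e8 : K * ‖x - γ (s + i * h)‖ + S ≤ α := by
        have : K * ‖x - γ (s + i * h)‖ + S ≤ (K + 1) * (‖x - γ (s + i * h)‖ + S) := by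
          have := norm_nonneg (x - γ (s + i * h))
          nlinarith
        refine this.trans (le_trans ?_ hsmall)
        gcongr
      obtain ⟨x', hx'Q, hseg, hx'e⟩ := exists_segment_near hc hQ hh hρ hρ1 e6 e5 hS e8
      rw [e1]
      refine ⟨x', mem_insert_of_mem _ hx'Q, ⟨x, hx, hxc, hseg⟩, hx'e.trans ?_⟩
      rw [pow_succ, ← mul_assoc]
      gcongr
  obtain ⟨x, hx, hxc, hxe⟩ := key m le_rfl
  rw [hm] at hxe
  refine ⟨x, hx, hxc, hxe.trans ?_⟩
  gcongr
  calc (1 + A * h) ^ m ≤ Real.exp (A * h) ^ m := by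
        gcongr
        linarith [Real.add_one_le_exp (A * h)]
    _ = Real.exp (A * (m * h)) := by rw [← Real.exp_nat_mul]; ring_nf
    _ = _ := by rw [← hm, add_sub_cancel_left]

/-- Points reachable from `y` are approximated by chains that start near `y`. -/
theorem exists_chainReach_near (hc : IsSpeed c α β K) {T : ℝ} (hT : 0 ≤ T) {η : ℝ}
    (hη : 0 < η) : ∃ δ > 0, ∀ {Q : Set (E n)}, Dense Q → ∀ {y y' x : E n} {s t : ℝ}, s ≤ t →
      t - s ≤ T → Reach c y s x t → ‖y' - y‖ < δ →
      ∃ (m : ℕ) (x' : E n), x' ∈ insert y' Q ∧ ChainReach c Q y' s ((t - s) / m) m x' ∧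
        ‖x' - x‖ < η := by
  have hα := hc.pos
  have hβ := hc.beta_pos
  have hK := hc.nonneg
  set A := (K + 1) * (β / α + 1) with hA
  have hA0 : 0 ≤ A := by positivity
  set X := Real.exp (A * T)
  have hX : 0 < X := Real.exp_pos _
  -- The final error is at most `2 * δ * X`. It must be below `η`, and small enough with respect to
  -- `α` for each step to be admissible.
  set δ := min 1 (min (η / (4 * X)) (α / ((K + 1) * (2 * X)))) with hδ
  have hδ0 : 0 < δ := by positivity
  have hδ1 : δ ≤ 1 := min_le_left _ _
  have hδ2 : 2 * δ * X < η := by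
    have : δ ≤ η / (4 * X) := (min_le_right _ _).trans (min_le_left _ _)
    rw [le_div_iff₀ (by positivity)] at this
    linarith
  have hδ3 : (K + 1) * (2 * δ * X) ≤ α := by
    have : δ ≤ α / ((K + 1) * (2 * X)) := (min_le_right _ _).trans (min_le_right _ _)
    rw [le_div_iff₀ (by positivity)] at this
    linarith
  refine ⟨δ, hδ0, fun {Q} hQ {y y' x s t} hst hT' ⟨γ, hγ, hs, ht⟩ hy => ?_⟩
  rcases hst.eq_or_lt with rfl | hlt
  · refine ⟨0, y', mem_insert _ _, rfl, ?_⟩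
    rw [← ht, hs]
    have h1 : 1 ≤ X := Real.one_le_exp (by positivity)
    nlinarith
  -- So many steps that the discretisation part of `S` is at most `δ / 2`; the other half is the
  -- rounding parameter `ρ`.
  obtain ⟨m, hm⟩ := exists_nat_gt (2 * (K * ((β + 2) * T)) / (δ / 2))
  have hm0 : 0 < (m : ℝ) := lt_of_le_of_lt (by positivity) hm
  rw [div_lt_iff₀ (by positivity)] at hm
  have hts : 0 < t - s := sub_pos.2 hlt
  set h := (t - s) / m
  have hh : 0 < h := by positivity
  have hmh : m * h = t - s := by simp only [h]; field_simp
  set S := δ / 2 + 2 * (K * ((β + 2) * h)) with hS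
  have hSδ : S ≤ δ := by
    have h1 : 2 * (K * ((β + 2) * h)) ≤ δ / 2 := by
      refine le_of_mul_le_mul_left ?_ hm0
      calc (m : ℝ) * (2 * (K * ((β + 2) * h))) = 2 * (K * ((β + 2) * (m * h))) := by ring
        _ ≤ 2 * (K * ((β + 2) * T)) := by rw [hmh]; gcongr
        _ ≤ _ := hm.le
    linarith
  have hS0 : 0 ≤ S := by positivity
  have hbound : (‖y' - γ s‖ + S) * Real.exp (A * (t - s)) ≤ 2 * δ * X := by
    rw [hs]
    gcongr
    · linarith
    · exact Real.exp_le_exp.2 (by gcongr)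
  obtain ⟨x', hx', hchain, hxe⟩ := hγ.exists_chainReach hc hQ hh (half_pos hδ0) (by linarith) hS
    (y := y') (m := m) (by linarith) (le_trans (by gcongr) hδ3)
  refine ⟨m, x', hx', hchain, ?_⟩
  rw [← ht]
  linarith

/-- Reachable points depend continuously on the starting point. -/
theorem exists_reach_near (hc : IsSpeed c α β K) {T : ℝ} (hT : 0 ≤ T) {η : ℝ}
    (hη : 0 < η) : ∃ δ > 0, ∀ {y y' x : E n} {s t : ℝ}, s ≤ t →
      t - s ≤ T → Reach c y s x t → ‖y' - y‖ < δ → ∃ x', Reach c y' s x' t ∧ ‖x' - x‖ < η := by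
  obtain ⟨δ, hδ, H⟩ := exists_chainReach_near hc hT hη
  refine ⟨δ, hδ, fun {y y' x s t} hst h1 h2 h3 => ?_⟩
  obtain ⟨m, x', -, hx', hn⟩ := H dense_univ hst h1 h2 h3
  exact ⟨x', hx'.reach_div hc hst, hn⟩

/-- Starting points depend continuously on the reached point. -/
theorem exists_reach_near' (hc : IsSpeed c α β K) {T : ℝ} (hT : 0 ≤ T) {η : ℝ}
    (hη : 0 < η) : ∃ δ > 0, ∀ {y x x' : E n} {s t : ℝ}, s ≤ t →
      t - s ≤ T → Reach c y s x t → ‖x' - x‖ < δ → ∃ y', Reach c y' s x' t ∧ ‖y' - y‖ < η := by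
  obtain ⟨δ, hδ, H⟩ := exists_reach_near hc.rev hT hη
  refine ⟨δ, hδ, fun {y x x' s t} hst h1 h2 h3 => ?_⟩
  obtain ⟨y', hy', hn⟩ := H (s := -t) (t := -s) (by linarith) (by linarith) h2.rev_aux h3
  exact ⟨y', Reach.rev_iff.1 hy', hn⟩

/-- For `t' ≥ t`, reach `x'` at time `t` and wait. For `t' ≤ t`, cut the path at `t'`, where it is
still within `β * (t - t')` of `x`. -/
theorem exists_reach_near_endpoint (hc : IsSpeed c α β K) {T : ℝ} (hT : 0 ≤ T) {η : ℝ}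
    (hη : 0 < η) : ∃ δ > 0, ∀ {y x x' : E n} {t t' : ℝ}, 0 ≤ t → t ≤ T → 0 ≤ t' →
      ‖x' - x‖ < δ → |t' - t| < δ → Reach c y 0 x t → ∃ y', Reach c y' 0 x' t' ∧ ‖y - y'‖ < η := by
  obtain ⟨δ, hδ, H⟩ := exists_reach_near' hc hT hη
  have hβ := hc.beta_pos
  have hδ' : δ / (β + 1) * (β + 1) = δ := div_mul_cancel₀ _ (by positivity)
  refine ⟨δ / (β + 1), by positivity, fun {y x x' t t'} ht htT ht' hx htt h => ?_⟩
  set d := δ / (β + 1)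
  have hd : 0 < d := by positivity
  rw [abs_lt] at htt
  rcases le_total t t' with hle | hle
  · obtain ⟨y', hy', hn⟩ := H ht (by linarith) h (x' := x') (by nlinarith)
    rw [norm_sub_rev] at hn
    exact ⟨y', hy'.trans ht hle (Reach.const hc _ hle), hn⟩
  · obtain ⟨z, hz, hzx⟩ := h.split ht' hle
    have h1 := hzx.norm_sub_le hc hle
    have h2 : ‖x' - z‖ < δ := by
      have := norm_sub_le_norm_sub_add_norm_sub x' x z
      have : β * (t - t') ≤ β * d := by gcongr; linarith
      linarith
    obtain ⟨y', hy', hn⟩ := H ht' (by linarith) hz h2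
    rw [norm_sub_rev] at hn
    exact ⟨y', hy', hn⟩

end StochHom

/-! ### The front propagation problem and the effective problem -/

namespace StochHom

variable {n : ℕ} {c : E n → ℝ → ℝ} {α β K : ℝ}

theorem eventually_nhdsGT_zero_mul_lt (a : ℝ) {η : ℝ} (hη : 0 < η) :
    ∀ᶠ h in 𝓝[>] (0 : ℝ), a * h < η := by
  have h1 : Continuous fun h : ℝ => a * h := by fun_prop
  exact (h1.continuousAt.eventually (gt_mem_nhds (by simpa using hη))).filter_mono
    nhdsWithin_le_nhds

theorem isUniqueViscositySolution_front (hc : IsSpeed c α β K) {u₀ : E n → ℝ}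
    (hu₀ : UniformContinuous u₀) :
    IsUniqueViscositySolution (fun x t p => c x t * ‖p‖) u₀ (valueFunction (Reach c) u₀) := by
  have hβ := hc.beta_pos
  have hα := hc.pos
  have hK := hc.nonneg
  refine isUniqueViscositySolution_of_lipschitz hβ hK (fun x t p q => ?_) (fun x y t s p => ?_) ?_
  · rw [← mul_sub, abs_mul, abs_of_nonneg (hc.speed_nonneg x t)]
    exact mul_le_mul (hc.upper x t) (abs_norm_sub_norm_le p q) (abs_nonneg _) hβ.le
  · rw [← sub_mul, abs_mul, abs_norm]
    gcongr
    exact hc.lip x y t s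
  refine isViscositySolution_valueFunction hβ.le (fun x y => Reach.refl_iff)
    (fun h1 h2 => Reach.trans h1 h2) (fun h1 h2 => Reach.split h1 h2)
    (fun _ h2 h => h.norm_sub_le hc h2) (fun x t ht => ⟨x, Reach.const hc x ht⟩) ?_ ?_ ?_ hu₀
  · intro x t ht η hη
    obtain ⟨δ, hδ, H⟩ := exists_reach_near_endpoint hc (T := t + 1) (by linarith) hη
    have h1 : ∀ᶠ z : E n × ℝ in 𝓝[univ ×ˢ Ici (0 : ℝ)] (x, t), dist z (x, t) < min δ 1 :=
      nhdsWithin_le_nhds (Metric.ball_mem_nhds _ (by positivity))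
    filter_upwards [h1, self_mem_nhdsWithin] with z hz hz0
    rw [Prod.dist_eq, max_lt_iff, dist_eq_norm, Real.dist_eq] at hz
    have h2 := hz.1.trans_le (min_le_left _ _)
    have h3 := hz.2.trans_le (min_le_left _ _)
    have h4 := (abs_lt.1 (hz.2.trans_le (min_le_right _ _))).2
    refine ⟨fun y hy => H ht (by linarith) hz0.2 h2 h3 hy, fun y' hy' => ?_⟩
    rw [norm_sub_rev] at h2
    rw [abs_sub_comm] at h3
    exact H hz0.2 (by linarith) ht h2 h3 hy'
  · intro x t ht p η hη
    have h0 : Ioi (0 : ℝ) ∈ 𝓝[>] (0 : ℝ) := self_mem_nhdsWithin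
    filter_upwards [h0, eventually_nhdsGT_zero_mul_lt (K * (β + 1)) hα,
      eventually_nhdsGT_zero_mul_lt (K * (β + 1) * ‖p‖) hη] with h hh h1 h2
    have hh : 0 < h := hh
    -- The least speed guaranteed near `(x, t)` for a duration `h`: a straight segment in direction
    -- `p` at speed `v` is admissible. For `p = 0` the convention `0⁻¹ = 0` makes it constant.
    set v := c x t - K * ((β + 1) * h) with hv
    have hv0 : 0 ≤ v := by have := hc.lower x t; linarith
    have hvβ : v ≤ β := by
      have := hc.upper x t
      have : 0 ≤ K * ((β + 1) * h) := by positivity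
      linarith
    have e1 : x - (x - (h * v * ‖p‖⁻¹) • p) = (h * v * ‖p‖⁻¹) • p := by abel
    have e2 : ‖(h * v * ‖p‖⁻¹) • p‖ ≤ h * v := by
      rw [norm_smul, Real.norm_eq_abs, abs_of_nonneg (by positivity), mul_assoc]
      exact mul_le_of_le_one_right (by positivity) inv_mul_le_one
    refine ⟨x - (h * v * ‖p‖⁻¹) • p, IsSegment.reach (by linarith) fun θ hθ => ?_, ?_⟩
    · rw [e1, sub_sub_cancel]
      refine e2.trans ((mul_comm h v).trans_le ?_)
      gcongr
      set w := (h * v * ‖p‖⁻¹) • p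
      have h3 : ‖x - w + θ • w - x‖ ≤ β * h := by
        have : x - w + θ • w - x = -((1 - θ) • w) := by rw [sub_smul, one_smul]; abel
        rw [this, norm_neg, norm_smul, Real.norm_eq_abs, abs_of_nonneg (by linarith [hθ.2])]
        calc (1 - θ) * ‖w‖ ≤ 1 * (h * v) := by
              gcongr
              linarith [hθ.1]
          _ ≤ 1 * (h * β) := by gcongr
          _ = _ := by ring
      have h4 : |t - h + θ * h - t| ≤ h := by
        rw [abs_le]
        constructor <;> nlinarith [hθ.1, hθ.2]
      have h5 := (abs_le.1 (hc.lip (x - w + θ • w) x (t - h + θ * h) t)).1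
      have h6 : K * (‖x - w + θ • w - x‖ + |t - h + θ * h - t|) ≤ K * ((β + 1) * h) :=
        mul_le_mul_of_nonneg_left (by linarith) hK
      linarith
    · rw [e1, inner_smul_right, real_inner_self_eq_norm_sq]
      have e3 : h * v * ‖p‖⁻¹ * ‖p‖ ^ 2 = h * (v * ‖p‖) := by
        rcases eq_or_ne ‖p‖ 0 with h0 | h0
        · simp [h0]
        · field_simp
      rw [e3]
      gcongr
      rw [hv, sub_mul]
      linarith
  · intro x t ht p η hη
    have h0 : Ioi (0 : ℝ) ∈ 𝓝[>] (0 : ℝ) := self_mem_nhdsWithin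
    filter_upwards [h0, eventually_nhdsGT_zero_mul_lt (K * (β + 1) * ‖p‖) hη] with h hh h2 y hy
    have hh : 0 < h := hh
    have h3 := hy.norm_sub_le_lip hc (by linarith)
    rw [sub_sub_cancel] at h3
    calc inner ℝ p (x - y) ≤ ‖p‖ * ‖x - y‖ := real_inner_le_norm _ _
      _ ≤ ‖p‖ * ((c x t + K * ((β + 1) * h)) * h) := by gcongr
      _ = h * (c x t * ‖p‖ + K * (β + 1) * ‖p‖ * h) := by ring
      _ ≤ _ := by gcongr

section Effective

variable {D : Set (E n)} {B : ℝ}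

theorem inner_le_effHamiltonian (hB : ∀ q ∈ D, ‖q‖ ≤ B) (p : E n) {q : E n} (hq : q ∈ D) :
    inner ℝ p q ≤ effHamiltonian D p := by
  refine le_csSup ⟨‖p‖ * B, ?_⟩ ⟨q, hq, rfl⟩
  rintro - ⟨q, hq, rfl⟩
  exact (real_inner_le_norm _ _).trans (by gcongr; exact hB q hq)

theorem effHamiltonian_le (hne : D.Nonempty) {p : E n} {r : ℝ} (h : ∀ q ∈ D, inner ℝ p q ≤ r) :
    effHamiltonian D p ≤ r :=
  csSup_le (hne.image _) (by rintro - ⟨q, hq, rfl⟩; exact h q hq)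

theorem effHamiltonian_sub_le (hne : D.Nonempty) (hB : ∀ q ∈ D, ‖q‖ ≤ B) (p p' : E n) :
    effHamiltonian D p - effHamiltonian D p' ≤ B * ‖p - p'‖ := by
  rw [sub_le_iff_le_add]
  refine effHamiltonian_le hne fun q hq => ?_
  have h1 := inner_le_effHamiltonian hB p' hq
  have h2 : inner ℝ p q = inner ℝ (p - p') q + inner ℝ p' q := by rw [← inner_add_left]; simp
  have h3 : inner ℝ (p - p') q ≤ B * ‖p - p'‖ := by
    refine (real_inner_le_norm _ _).trans ?_
    rw [mul_comm]
    gcongr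
    exact hB q hq
  linarith

theorem hopfLax_eq_valueFunction (u₀ : E n → ℝ) : hopfLax D u₀ =
    valueFunction (fun y s x t => ∃ q ∈ D, x = y + (t - s) • q) u₀ := by
  ext z
  simp [hopfLax, valueFunction]

/-- The relation `x ∈ y + (t - s) D` plays the role of reachability. Convexity of `D` serves to
concatenate: a weighted mean of two velocities is again in `D`. -/
theorem isUniqueViscositySolution_hopfLax (hD : IsCompact D) (hconv : Convex ℝ D)
    (hne : D.Nonempty) {u₀ : E n → ℝ} (hu₀ : UniformContinuous u₀) :
    IsUniqueViscositySolution (fun _ _ p => effHamiltonian D p) u₀ (hopfLax D u₀) := by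
  obtain ⟨B, hB0, hB⟩ : ∃ B > 0, ∀ q ∈ D, ‖q‖ ≤ B := by
    obtain ⟨B, hB⟩ := hD.exists_bound_of_continuousOn continuousOn_id
    exact ⟨max B 1, by positivity, fun q hq => (hB q hq).trans (le_max_left _ _)⟩
  refine isUniqueViscositySolution_of_lipschitz hB0 le_rfl (fun x t p q => ?_)
    (fun x y t s p => by simp) ?_
  · have h1 := effHamiltonian_sub_le hne hB p q
    have h2 := effHamiltonian_sub_le hne hB q p
    rw [norm_sub_rev] at h2
    exact abs_le.2 ⟨by linarith, h1⟩
  rw [hopfLax_eq_valueFunction]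
  obtain ⟨q₀, hq₀⟩ := hne
  refine isViscositySolution_valueFunction hB0.le (fun x y => ?_) ?_ ?_ ?_ ?_ ?_ ?_ ?_ hu₀
  · refine ⟨fun ⟨q, _, h⟩ => by simpa using h.symm, fun h => ⟨q₀, hq₀, by simp [h]⟩⟩
  · rintro y z x s t hs hst ⟨q₁, hq₁, rfl⟩ ⟨q₂, hq₂, rfl⟩
    -- Separated because `t` may vanish, and the weights below divide by `t`.
    rcases hs.eq_or_lt with rfl | hs
    · exact ⟨q₂, hq₂, by simp⟩
    have ht : 0 < t := hs.trans_le hst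
    refine ⟨(s / t) • q₁ + ((t - s) / t) • q₂, hconv hq₁ hq₂ (by positivity)
      (div_nonneg (sub_nonneg.2 hst) ht.le) (by field_simp; ring), ?_⟩
    rw [smul_add, smul_smul, smul_smul, sub_zero, sub_zero, mul_div_cancel₀ _ ht.ne',
      mul_div_cancel₀ _ ht.ne', add_assoc]
  · rintro y x s t hs hst ⟨q, hq, rfl⟩
    refine ⟨y + (s - 0) • q, ⟨q, hq, rfl⟩, q, hq, ?_⟩
    rw [add_assoc, ← add_smul]
    congr 2
    ring
  · rintro y x s t hs hst ⟨q, hq, rfl⟩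
    rw [add_sub_cancel_left, norm_smul, Real.norm_eq_abs, abs_of_nonneg (sub_nonneg.2 hst),
      mul_comm]
    have := hB q hq
    have := sub_nonneg.2 hst
    gcongr
  · exact fun x t _ => ⟨x - (t - 0) • q₀, q₀, hq₀, by simp⟩
  · intro x t ht η hη
    have h1 : Continuous fun z : E n × ℝ => ‖x - z.1‖ + B * |t - z.2| := by fun_prop
    have h2 : ∀ᶠ z : E n × ℝ in 𝓝[univ ×ˢ Ici (0 : ℝ)] (x, t), ‖x - z.1‖ + B * |t - z.2| < η :=
      (h1.continuousAt.eventually (gt_mem_nhds (by simpa using hη))).filter_mono nhdsWithin_le_nhds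
    have h3 : ∀ (z : E n × ℝ), ∀ q ∈ D, ‖(x - t • q) - (z.1 - z.2 • q)‖ ≤
        ‖x - z.1‖ + B * |t - z.2| := fun z q hq => by
      have : (x - t • q) - (z.1 - z.2 • q) = (x - z.1) - (t - z.2) • q := by rw [sub_smul]; abel
      rw [this]
      refine (norm_sub_le _ _).trans ?_
      rw [norm_smul, Real.norm_eq_abs, mul_comm B]
      gcongr
      exact hB q hq
    filter_upwards [h2] with z hz
    constructor
    · rintro y ⟨q, hq, h⟩
      refine ⟨z.1 - z.2 • q, ⟨q, hq, by simp⟩, ?_⟩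
      rw [sub_zero] at h
      rw [eq_sub_of_add_eq h.symm]
      exact (h3 z q hq).trans_lt hz
    · rintro y ⟨q, hq, h⟩
      refine ⟨x - t • q, ⟨q, hq, by simp⟩, ?_⟩
      rw [sub_zero] at h
      rw [eq_sub_of_add_eq h.symm, norm_sub_rev]
      exact (h3 z q hq).trans_lt hz
  · intro x t ht p η hη
    obtain ⟨q, hq, hqm⟩ := hD.exists_isMaxOn ⟨q₀, hq₀⟩
      (f := fun q : E n => inner ℝ p q) (by fun_prop)
    filter_upwards [self_mem_nhdsWithin] with h hh
    have hh : 0 < h := hh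
    refine ⟨x - h • q, ⟨q, hq, by simp⟩, ?_⟩
    rw [sub_sub_cancel, inner_smul_right]
    have : effHamiltonian D p ≤ inner ℝ p q := effHamiltonian_le ⟨q₀, hq₀⟩ fun q' hq' => hqm hq'
    gcongr
    linarith
  · intro x t ht p η hη
    filter_upwards [self_mem_nhdsWithin] with h hh
    have hh : 0 < h := hh
    rintro y ⟨q, hq, hx⟩
    rw [sub_sub_cancel] at hx
    rw [hx, add_sub_cancel_left, inner_smul_right]
    have := inner_le_effHamiltonian hB p hq
    gcongr
    linarith

end Effective

end StochHom

/-! ### Independence of the starting point and almost additive support functions -/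

namespace StochHom

variable {n : ℕ} {c : E n → ℝ → ℝ} {α β K : ℝ}

theorem exists_intVec_near (z x : E n) : ∃ l : Fin n → ℤ, ‖z + intVec l - x‖ ≤ √n := by
  refine ⟨fun i => -⌊z i - x i⌋, ?_⟩
  rw [EuclideanSpace.norm_eq]
  refine Real.sqrt_le_sqrt ?_
  have h1 : ∀ i, ‖(z + intVec (fun i => -⌊z i - x i⌋) - x) i‖ ^ 2 ≤ 1 := fun i => by
    have h2 : (z + intVec (fun i => -⌊z i - x i⌋) - x) i = Int.fract (z i - x i) := by
      change z i + ((-⌊z i - x i⌋ : ℤ) : ℝ) - x i = _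
      rw [← Int.self_sub_floor]
      push_cast
      ring
    rw [h2, Real.norm_eq_abs, abs_of_nonneg (Int.fract_nonneg _)]
    exact pow_le_one₀ (Int.fract_nonneg _) (Int.fract_lt_one _).le
  calc _ ≤ ∑ _i : Fin n, (1 : ℝ) := Finset.sum_le_sum fun i _ => h1 i
    _ = n := by simp

/-- Periodicity in space. -/
def IsPeriodic (c : E n → ℝ → ℝ) : Prop :=
  ∀ (l : Fin n → ℤ) (x : E n) (t : ℝ), c (x + intVec l) t = c x t

/-- Bound for the dependence of reachable displacements on the starting point. -/
noncomputable def discrepancy (n : ℕ) (α β : ℝ) : ℝ := √n + β * (√n / α)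

theorem discrepancy_nonneg (n : ℕ) {α β : ℝ} (hα : 0 ≤ α) (hβ : 0 ≤ β) :
    0 ≤ discrepancy n α β := by
  unfold discrepancy
  positivity

/-- Up to a bounded error, the reachable displacements do not depend on the starting point. -/
theorem Reach.exists_of_start (hc : IsSpeed c α β K) (hper : IsPeriodic c) {y x : E n} {s t : ℝ}
    (hst : s ≤ t) (h : Reach c y s x t) (y' : E n) :
    ∃ x', Reach c y' s x' t ∧ ‖(x' - y') - (x - y)‖ ≤ discrepancy n α β := by
  have hα := hc.pos
  have hβ := hc.beta_pos
  have hn : 0 ≤ √(n : ℝ) := Real.sqrt_nonneg _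
  -- A time `√n / α` suffices to go from `y'` to an integer translate of the point `z` that the
  -- given path occupies at the end of that time; the translated path is followed afterwards. If
  -- less time is available, staying put is good enough.
  rcases le_total t (s + √n / α) with hle | hle
  · refine ⟨y', Reach.const hc _ hst, ?_⟩
    rw [sub_self, zero_sub, norm_neg]
    refine (h.norm_sub_le hc hst).trans ?_
    have : β * (t - s) ≤ β * (√n / α) := by gcongr; linarith
    unfold discrepancy
    linarith
  · have h0 : s ≤ s + √n / α := le_add_of_nonneg_right (by positivity)
    obtain ⟨z, hz, hzx⟩ := h.split h0 hle
    obtain ⟨l, hl⟩ := exists_intVec_near z y'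
    refine ⟨x + intVec l, Reach.trans h0 hle (Reach.of_norm_le hc h0 ?_)
      (hzx.add_vec (fun x t => hper l x t)), ?_⟩
    · rw [add_sub_cancel_left, mul_div_cancel₀ _ hα.ne']
      exact hl
    · have h1 : (x + intVec l - y') - (x - y) = (z + intVec l - y') - (z - y) := by abel
      rw [h1]
      refine (_root_.norm_sub_le _ _).trans (add_le_add hl ?_)
      have := hz.norm_sub_le hc h0
      rwa [add_sub_cancel_left] at this

/-- Support function of the set of points reachable from the origin during `[s,t]`. -/
noncomputable def reachSupport (c : E n → ℝ → ℝ) (p : E n) (s t : ℝ) : ℝ :=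
  sSup ((fun x : E n => inner ℝ p x) '' {x | Reach c 0 s x t})

theorem inner_le_of_reach (hc : IsSpeed c α β K) (p : E n) {s t : ℝ} (hst : s ≤ t) {x : E n}
    (h : Reach c 0 s x t) : |inner ℝ p x| ≤ ‖p‖ * (β * (t - s)) := by
  refine (abs_real_inner_le_norm p x).trans ?_
  have := h.norm_sub_le hc hst
  rw [sub_zero] at this
  gcongr

theorem inner_le_reachSupport (hc : IsSpeed c α β K) (p : E n) {s t : ℝ} (hst : s ≤ t) {x : E n}
    (h : Reach c 0 s x t) : inner ℝ p x ≤ reachSupport c p s t := by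
  refine le_csSup ⟨‖p‖ * (β * (t - s)), ?_⟩ ⟨x, h, rfl⟩
  rintro - ⟨x, hx, rfl⟩
  exact (le_abs_self _).trans (inner_le_of_reach hc p hst hx)

theorem reachSupport_le (hc : IsSpeed c α β K) {p : E n} {s t : ℝ} (hst : s ≤ t) {r : ℝ}
    (h : ∀ x, Reach c 0 s x t → inner ℝ p x ≤ r) : reachSupport c p s t ≤ r :=
  csSup_le (Nonempty.image _ ⟨0, Reach.const hc 0 hst⟩) (by rintro - ⟨x, hx, rfl⟩; exact h x hx)

theorem exists_lt_inner_of_lt_reachSupport (hc : IsSpeed c α β K) {p : E n} {s t : ℝ}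
    (hst : s ≤ t) {r : ℝ} (h : r < reachSupport c p s t) :
    ∃ x, Reach c 0 s x t ∧ r < inner ℝ p x := by
  obtain ⟨-, ⟨x, hx, rfl⟩, hr⟩ :=
    exists_lt_of_lt_csSup (Nonempty.image _ ⟨0, Reach.const hc 0 hst⟩) h
  exact ⟨x, hx, hr⟩

theorem abs_reachSupport_le (hc : IsSpeed c α β K) (p : E n) {s t : ℝ} (hst : s ≤ t) :
    |reachSupport c p s t| ≤ ‖p‖ * (β * (t - s)) := by
  have h0 := Reach.const hc (0 : E n) hst
  have h1 := inner_le_reachSupport hc p hst h0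
  have h2 : 0 ≤ ‖p‖ * (β * (t - s)) := by
    have := hc.beta_pos
    have := sub_nonneg.2 hst
    positivity
  rw [inner_zero_right] at h1
  exact abs_le.2 ⟨by linarith, reachSupport_le hc hst fun x hx =>
    (le_abs_self _).trans (inner_le_of_reach hc p hst hx)⟩

/-- The support functions of reachable sets are additive in time up to a bounded error. -/
theorem abs_reachSupport_sub_le (hc : IsSpeed c α β K) (hper : IsPeriodic c) (p : E n)
    {s r t : ℝ} (hsr : s ≤ r) (hrt : r ≤ t) :
    |reachSupport c p s t - reachSupport c p s r - reachSupport c p r t| ≤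
      ‖p‖ * discrepancy n α β := by
  have hst := hsr.trans hrt
  have hin : ∀ v w : E n, ‖v - w‖ ≤ discrepancy n α β →
      inner ℝ p v ≤ inner ℝ p w + ‖p‖ * discrepancy n α β := fun v w hvw => by
    have h1 : inner ℝ p v = inner ℝ p w + inner ℝ p (v - w) := by rw [inner_sub_right]; ring
    rw [h1]
    gcongr
    exact (real_inner_le_norm _ _).trans (by gcongr)
  refine abs_le.2 ⟨?_, ?_⟩
  · refine le_of_forall_pos_lt_add fun ε hε => ?_
    obtain ⟨z, hz, hz'⟩ := exists_lt_inner_of_lt_reachSupport hc hsr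
      (sub_lt_self (reachSupport c p s r) (half_pos hε))
    obtain ⟨w, hw, hw'⟩ := exists_lt_inner_of_lt_reachSupport hc hrt
      (sub_lt_self (reachSupport c p r t) (half_pos hε))
    obtain ⟨x, hx, hxw⟩ := hw.exists_of_start hc hper hrt z
    rw [sub_zero, norm_sub_rev] at hxw
    have h1 := hin _ _ hxw
    have h2 := inner_le_reachSupport hc p hst (hz.trans hsr hrt hx)
    rw [inner_sub_right] at h1
    linarith
  · rw [sub_le_iff_le_add, sub_le_iff_le_add]
    refine reachSupport_le hc hst fun x hx => ?_
    obtain ⟨z, hz, hzx⟩ := hx.split hsr hrt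
    obtain ⟨w, hw, hwx⟩ := hzx.exists_of_start hc hper hrt 0
    rw [sub_zero, norm_sub_rev] at hwx
    have h1 := hin _ _ hwx
    have h2 := inner_le_reachSupport hc p hsr hz
    have h3 := inner_le_reachSupport hc p hrt hw
    rw [inner_sub_right] at h1
    linarith

/-! ### Asymptotic convexity of reachable sets -/

section Convexity

/-- Otherwise `A`, and with it its convex hull, would lie in an open half-space that excludes `g`.
-/
theorem exists_mem_inner_sub_nonpos {A : Set (E n)} {g : E n} (hg : g ∈ convexHull ℝ A) (e : E n) :
    ∃ d ∈ A, inner ℝ e (d - g) ≤ 0 := by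
  by_contra! h
  have h1 : A ⊆ {d | inner ℝ e g < inner ℝ e d} := fun d hd => by
    have := h d hd
    rw [inner_sub_right] at this
    exact sub_pos.1 this
  have h2 : Convex ℝ {d : E n | inner ℝ e g < inner ℝ e d} :=
    convex_halfSpace_gt (IsLinearMap.mk (fun x y => inner_add_right _ _ _)
      (fun a x => by simp [inner_smul_right])) _
  exact lt_irrefl (inner ℝ e g) (convexHull_min h1 h2 hg)

/-- A sum of points of convex hulls is close to a sum of points of the sets. -/
theorem exists_sum_near_of_convexHull {A : ℕ → Set (E n)} {g : ℕ → E n} {r : ℝ} (m : ℕ)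
    (hA : ∀ j < m, A j ⊆ Metric.closedBall 0 r) (hg : ∀ j < m, g j ∈ convexHull ℝ (A j)) :
    ∃ d : ℕ → E n, (∀ j < m, d j ∈ A j) ∧
      ‖∑ j ∈ Finset.range m, d j - ∑ j ∈ Finset.range m, g j‖ ^ 2 ≤ m * (2 * r) ^ 2 := by
  induction m with
  | zero => exact ⟨fun _ => 0, fun j hj => absurd hj (Nat.not_lt_zero j), by simp⟩
  | succ m ih =>
    obtain ⟨d, hd, hdn⟩ := ih (fun j hj => hA j (hj.trans (Nat.lt_succ_self m)))
      fun j hj => hg j (hj.trans (Nat.lt_succ_self m))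
    set e := ∑ j ∈ Finset.range m, d j - ∑ j ∈ Finset.range m, g j with he
    -- Greedy choice: the new deviation makes a nonpositive inner product with the accumulated error
    -- `e`, so the squared errors add up. The error grows like `√m` instead of `m`.
    obtain ⟨v, hv, hve⟩ := exists_mem_inner_sub_nonpos (hg m (Nat.lt_succ_self m)) e
    have hball := hA m (Nat.lt_succ_self m)
    have h1 : ‖v‖ ≤ r := by simpa using hball hv
    have h2 : ‖g m‖ ≤ r := by
      simpa using convexHull_min hball (convex_closedBall _ _) (hg m (Nat.lt_succ_self m))
    refine ⟨Function.update d m v, fun j hj => ?_, ?_⟩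
    · rcases (Nat.lt_succ_iff_lt_or_eq.1 hj) with h | rfl
      · rw [Function.update_of_ne h.ne]
        exact hd j h
      · rwa [Function.update_self]
    · have h3 : ∑ j ∈ Finset.range m, Function.update d m v j = ∑ j ∈ Finset.range m, d j :=
        Finset.sum_congr rfl fun j hj => Function.update_of_ne (Finset.mem_range.1 hj).ne _ _
      rw [Finset.sum_range_succ, Finset.sum_range_succ, Function.update_self, h3]
      have h4 : ∑ j ∈ Finset.range m, d j + v - (∑ j ∈ Finset.range m, g j + g m) =
          e + (v - g m) := by
        rw [he]
        abel
      rw [h4, norm_add_sq_real]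
      have h5 : ‖v - g m‖ ^ 2 ≤ (2 * r) ^ 2 := by
        gcongr
        exact (norm_sub_le _ _).trans (by linarith)
      push_cast
      linarith

variable (hc : IsSpeed c α β K) (hper : IsPeriodic c) {L : ℝ} (hL : 0 ≤ L)
include hc hper hL

/-- Each block of the path is restarted at the origin, at the cost of one discrepancy. -/
theorem exists_sum_blocks_near {m : ℕ} {x : E n} (h : Reach c 0 0 x (m * L)) :
    ∃ d : ℕ → E n, (∀ j < m, Reach c 0 (j * L) (d j) (j * L + L)) ∧
      ‖x - ∑ j ∈ Finset.range m, d j‖ ≤ m * discrepancy n α β := by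
  induction m generalizing x with
  | zero =>
    refine ⟨fun _ => 0, fun j hj => absurd hj (Nat.not_lt_zero j), ?_⟩
    have h1 := h.norm_sub_le hc (by simp)
    simpa using h1
  | succ m ih =>
    have h1 : ((m + 1 : ℕ) : ℝ) * L = m * L + L := by push_cast; ring
    rw [h1] at h
    obtain ⟨z, hz, hzx⟩ := h.split (by positivity) (le_add_of_nonneg_right hL)
    obtain ⟨d, hd, hdn⟩ := ih hz
    obtain ⟨w, hw, hwn⟩ := hzx.exists_of_start hc hper (le_add_of_nonneg_right hL) 0
    refine ⟨Function.update d m w, fun j hj => ?_, ?_⟩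
    · rcases (Nat.lt_succ_iff_lt_or_eq.1 hj) with h | rfl
      · rw [Function.update_of_ne h.ne]
        exact hd j h
      · rwa [Function.update_self]
    · have h3 : ∑ j ∈ Finset.range m, Function.update d m w j = ∑ j ∈ Finset.range m, d j :=
        Finset.sum_congr rfl fun j hj => Function.update_of_ne (Finset.mem_range.1 hj).ne _ _
      rw [Finset.sum_range_succ, Function.update_self, h3]
      have h4 : x - (∑ j ∈ Finset.range m, d j + w) =
          (z - ∑ j ∈ Finset.range m, d j) - ((w - 0) - (x - z)) := by
        rw [sub_zero]
        abel
      rw [h4]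
      refine (norm_sub_le _ _).trans ?_
      push_cast
      linarith

theorem exists_reach_near_sum_blocks {m : ℕ} {d : ℕ → E n}
    (hd : ∀ j < m, Reach c 0 (j * L) (d j) (j * L + L)) :
    ∃ x, Reach c 0 0 x (m * L) ∧
      ‖x - ∑ j ∈ Finset.range m, d j‖ ≤ m * discrepancy n α β := by
  induction m with
  | zero => exact ⟨0, Reach.const hc 0 (by simp), by simp⟩
  | succ m ih =>
    obtain ⟨z, hz, hzn⟩ := ih fun j hj => hd j (hj.trans (Nat.lt_succ_self m))
    have h1 : ((m + 1 : ℕ) : ℝ) * L = m * L + L := by push_cast; ring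
    obtain ⟨x, hx, hxn⟩ := (hd m (Nat.lt_succ_self m)).exists_of_start hc hper
      (le_add_of_nonneg_right hL) z
    rw [h1]
    refine ⟨x, hz.trans (by positivity) (le_add_of_nonneg_right hL) hx, ?_⟩
    rw [Finset.sum_range_succ]
    have h4 : x - (∑ j ∈ Finset.range m, d j + d m) =
        (z - ∑ j ∈ Finset.range m, d j) + ((x - z) - (d m - 0)) := by
      rw [sub_zero]
      abel
    rw [h4]
    refine (norm_add_le _ _).trans ?_
    push_cast
    linarith

/-- The points within `m * discrepancy n α β` of a sum of points from the convex hulls of the blocks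
form a convex set that contains the reachable set, hence its hull. Replacing hull points by points
of the blocks costs `√m` times the block size, and reassembling a path costs the same discrepancies
again. -/
theorem exists_reach_near_convexHull_blocks {m : ℕ} {q : E n}
    (hq : q ∈ convexHull ℝ {x | Reach c 0 0 x (m * L)}) :
    ∃ x, Reach c 0 0 x (m * L) ∧
      ‖x - q‖ ≤ 2 * (m * discrepancy n α β) + √m * (2 * (β * L)) := by
  have hβ := hc.beta_pos
  set A : ℕ → Set (E n) := fun j => {d | Reach c 0 (j * L) d (j * L + L)} with hA
  have h1 : {x | Reach c 0 0 x (m * L)} ⊆ {q | ∃ g : ℕ → E n,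
      (∀ j < m, g j ∈ convexHull ℝ (A j)) ∧
      ‖q - ∑ j ∈ Finset.range m, g j‖ ≤ m * discrepancy n α β} := fun x hx => by
    obtain ⟨d, hd, hdn⟩ := exists_sum_blocks_near hc hper hL hx
    exact ⟨d, fun j hj => subset_convexHull ℝ _ (hd j hj), hdn⟩
  have h2 : Convex ℝ {q | ∃ g : ℕ → E n, (∀ j < m, g j ∈ convexHull ℝ (A j)) ∧
      ‖q - ∑ j ∈ Finset.range m, g j‖ ≤ m * discrepancy n α β} := by
    rintro q₁ ⟨g₁, hg₁, hn₁⟩ q₂ ⟨g₂, hg₂, hn₂⟩ a b ha hb hab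
    refine ⟨fun j => a • g₁ j + b • g₂ j,
      fun j hj => convex_convexHull ℝ _ (hg₁ j hj) (hg₂ j hj) ha hb hab, ?_⟩
    rw [Finset.sum_add_distrib, ← Finset.smul_sum, ← Finset.smul_sum]
    have h3 : a • q₁ + b • q₂ - (a • ∑ j ∈ Finset.range m, g₁ j +
        b • ∑ j ∈ Finset.range m, g₂ j) = a • (q₁ - ∑ j ∈ Finset.range m, g₁ j) +
        b • (q₂ - ∑ j ∈ Finset.range m, g₂ j) := by
      rw [smul_sub, smul_sub]
      abel
    rw [h3]
    refine (norm_add_le _ _).trans ?_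
    rw [norm_smul, norm_smul, Real.norm_eq_abs, Real.norm_eq_abs, abs_of_nonneg ha,
      abs_of_nonneg hb]
    calc _ ≤ a * (m * discrepancy n α β) + b * (m * discrepancy n α β) := by gcongr
      _ = _ := by rw [← add_mul, hab, one_mul]
  obtain ⟨g, hg, hgn⟩ := convexHull_min h1 h2 hq
  obtain ⟨d, hd, hdn⟩ := exists_sum_near_of_convexHull (r := β * L) m (fun j hj v hv => by
    have := Reach.norm_sub_le hc (le_add_of_nonneg_right hL) hv
    rw [add_sub_cancel_left] at this
    rwa [mem_closedBall_iff_norm]) hg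
  obtain ⟨x, hx, hxn⟩ := exists_reach_near_sum_blocks hc hper hL hd
  refine ⟨x, hx, ?_⟩
  have h3 : ‖∑ j ∈ Finset.range m, d j - ∑ j ∈ Finset.range m, g j‖ ≤ √m * (2 * (β * L)) := by
    refine le_of_sq_le_sq ?_ (by positivity)
    rwa [mul_pow, Real.sq_sqrt (Nat.cast_nonneg m)]
  have h4 : x - q = (x - ∑ j ∈ Finset.range m, d j) +
      (∑ j ∈ Finset.range m, d j - ∑ j ∈ Finset.range m, g j) -
      (q - ∑ j ∈ Finset.range m, g j) := by abel
  rw [h4]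
  refine (norm_sub_le _ _).trans ?_
  have := norm_add_le (x - ∑ j ∈ Finset.range m, d j)
    (∑ j ∈ Finset.range m, d j - ∑ j ∈ Finset.range m, g j)
  linarith

omit hL

/-- Large reachable sets are almost convex. -/
theorem eventually_exists_reach_near_convexHull {η : ℝ} (hη : 0 < η) :
    ∀ᶠ t : ℝ in atTop, ∀ q ∈ convexHull ℝ {x | Reach c 0 0 x t},
      ∃ x, Reach c 0 0 x t ∧ ‖x - q‖ ≤ η * t := by
  have hβ := hc.beta_pos
  have hC := discrepancy_nonneg n hc.pos.le hβ.le
  -- With `L = t / m`, the term of order `β * t / √m` is then below `η / 2 * t`; the number of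
  -- blocks stays fixed as `t` grows.
  obtain ⟨m, hm⟩ := exists_nat_gt ((4 * β / η) ^ 2)
  have hm0 : (0 : ℝ) < m := lt_of_le_of_lt (by positivity) hm
  have hsm : 4 * β / η < √m := Real.lt_sqrt_of_sq_lt hm
  rw [div_lt_iff₀ hη] at hsm
  filter_upwards [eventually_ge_atTop (4 * (m * discrepancy n α β) / η),
    eventually_ge_atTop 0] with t ht ht0 q hq
  rw [div_le_iff₀ hη] at ht
  have h1 : (m : ℝ) * (t / m) = t := by field_simp
  have h2 := exists_reach_near_convexHull_blocks hc hper (L := t / m) (by positivity) (m := m)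
    (q := q) (by rwa [h1])
  rw [h1] at h2
  obtain ⟨x, hx, hxn⟩ := h2
  refine ⟨x, hx, hxn.trans ?_⟩
  have h3 : √(m : ℝ) * (2 * (β * (t / m))) ≤ η / 2 * t := by
    have h4 : 0 < √(m : ℝ) := Real.sqrt_pos.2 hm0
    have h5 : √(m : ℝ) * (2 * (β * (t / m))) = 2 * β * t / √m := by
      nth_rewrite 2 [← Real.sq_sqrt hm0.le]
      field_simp
    rw [h5, div_le_iff₀ h4]
    nlinarith
  linarith

end Convexity

end StochHom

/-! ### Measurability of the support functions and their ergodic limit -/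

namespace StochHom

variable {n : ℕ}

theorem IsSpeed.continuous {c : E n → ℝ → ℝ} {α β K : ℝ} (hc : IsSpeed c α β K) :
    Continuous fun z : E n × ℝ => c z.1 z.2 := by
  refine LipschitzWith.continuous (K := ⟨2 * K, by have := hc.nonneg; positivity⟩)
    (LipschitzWith.of_dist_le_mul fun z w => ?_)
  rw [Real.dist_eq]
  refine (hc.lip _ _ _ _).trans ?_
  change _ ≤ 2 * K * dist z w
  have h1 : ‖z.1 - w.1‖ ≤ dist z w := by
    rw [← dist_eq_norm]
    exact le_max_left _ _
  have h2 : |z.2 - w.2| ≤ dist z w := by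
    rw [← Real.dist_eq]
    exact le_max_right _ _
  have := hc.nonneg
  nlinarith

section Measurability

variable {Ω : Type*} [MeasurableSpace Ω] {a : E n → ℝ → Ω → ℝ} {α β : ℝ}
  (hm : Measurable fun z : (E n × ℝ) × Ω => a z.1.1 z.1.2 z.2)
  (hs : ∀ ω, ∃ K, IsSpeed (fun y s => a y s ω) α β K)
include hm hs

/-- The constraint is closed and continuous in `θ`, so a countable dense set of parameters suffices.
-/
theorem measurableSet_isSegment (y : E n) (s : ℝ) (x : E n) (t : ℝ) :
    MeasurableSet {ω | IsSegment (fun y s => a y s ω) y s x t} := by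
  obtain ⟨D, hDc, hD⟩ := TopologicalSpace.exists_countable_dense (Icc (0 : ℝ) 1)
  have h1 : {ω | IsSegment (fun y s => a y s ω) y s x t} = ⋂ θ ∈ D,
      {ω | ‖x - y‖ ≤ a (y + (θ : ℝ) • (x - y)) (s + θ * (t - s)) ω * (t - s)} := by
    ext ω
    simp only [mem_ofPred_eq, mem_iInter]
    refine ⟨fun h θ _ => h θ θ.2, fun h θ hθ => ?_⟩
    obtain ⟨K, hc⟩ := hs ω
    have hcont : Continuous fun θ : Icc (0 : ℝ) 1 =>
        a (y + (θ : ℝ) • (x - y)) (s + θ * (t - s)) ω * (t - s) := by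
      have : Continuous fun θ : Icc (0 : ℝ) 1 => (y + (θ : ℝ) • (x - y), s + (θ : ℝ) * (t - s)) :=
        by fun_prop
      exact (hc.continuous.comp this).mul continuous_const
    have hcl : IsClosed {θ : Icc (0 : ℝ) 1 |
        ‖x - y‖ ≤ a (y + (θ : ℝ) • (x - y)) (s + θ * (t - s)) ω * (t - s)} :=
      isClosed_le continuous_const hcont
    have hsub := hcl.closure_subset_iff.2 (fun θ hθ => h θ hθ : D ⊆ _)
    exact hsub (hD ⟨θ, hθ⟩)
  rw [h1]
  refine MeasurableSet.biInter hDc fun θ _ => measurableSet_le measurable_const ?_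
  have h2 : Measurable fun ω => a (y + (θ : ℝ) • (x - y)) (s + θ * (t - s)) ω :=
    hm.comp (g := fun z : (E n × ℝ) × Ω => a z.1.1 z.1.2 z.2)
      ((measurable_const (a := (y + (θ : ℝ) • (x - y), s + θ * (t - s)))).prodMk measurable_id)
  exact h2.mul_const _

theorem measurableSet_chainReach {Q : Set (E n)} (hQ : Q.Countable) (y : E n) (s h : ℝ) (m : ℕ)
    (x : E n) : MeasurableSet {ω | ChainReach (fun y s => a y s ω) Q y s h m x} := by
  induction m generalizing x with
  | zero => exact MeasurableSet.const _
  | succ m ih =>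
    have h1 : {ω | ChainReach (fun y s => a y s ω) Q y s h (m + 1) x} = ⋃ z ∈ insert y Q,
        ({ω | ChainReach (fun y s => a y s ω) Q y s h m z} ∩
          {ω | IsSegment (fun y s => a y s ω) z (s + m * h) x (s + m * h + h)}) := by
      ext ω
      simp only [mem_iUnion, exists_prop]
      rfl
    rw [h1]
    exact MeasurableSet.biUnion (hQ.insert y) fun z _ =>
      (ih z).inter (measurableSet_isSegment hm hs _ _ _ _)

/-- Exceeding `r` is an open condition on the end point, and chains with nodes in a countable dense
set approximate every reachable point. The event is thus a countable union of chain events. -/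
theorem measurable_reachSupport (p : E n) {s t : ℝ} (hst : s ≤ t) :
    Measurable fun ω => reachSupport (fun y s => a y s ω) p s t := by
  obtain ⟨Q, hQc, hQ⟩ := TopologicalSpace.exists_countable_dense (E n)
  refine measurable_of_Ioi fun r => ?_
  have h1 : (fun ω => reachSupport (fun y s => a y s ω) p s t) ⁻¹' Ioi r =
      ⋃ m : ℕ, ⋃ x ∈ {x ∈ insert 0 Q | r < inner ℝ p x},
        {ω | ChainReach (fun y s => a y s ω) Q 0 s ((t - s) / m) m x} := by
    ext ω
    obtain ⟨K, hc⟩ := hs ω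
    simp only [mem_preimage, mem_Ioi, mem_iUnion, exists_prop]
    constructor
    · intro h
      obtain ⟨x, hx, hr⟩ := exists_lt_inner_of_lt_reachSupport hc hst h
      have hη : 0 < (inner ℝ p x - r) / (‖p‖ + 1) := div_pos (sub_pos.2 hr) (by positivity)
      obtain ⟨δ, hδ, H⟩ := exists_chainReach_near hc (sub_nonneg.2 hst) hη
      obtain ⟨m, x', hx', hch, hn⟩ := H hQ hst le_rfl hx (y' := 0) (by simpa using hδ)
      refine ⟨m, x', ⟨hx', ?_⟩, hch⟩
      rw [lt_div_iff₀ (by positivity)] at hn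
      have h2 := (abs_le.1 (abs_real_inner_le_norm p (x' - x))).1
      rw [inner_sub_right] at h2
      rcases (norm_nonneg (x' - x)).eq_or_lt with h3 | h3
      · rw [← h3] at h2
        linarith
      · linarith
    · rintro ⟨m, x, hx, hch⟩
      exact hx.2.trans_le (inner_le_reachSupport hc p hst (hch.reach_div hc hst))
  rw [h1]
  exact MeasurableSet.iUnion fun m => MeasurableSet.biUnion ((hQc.insert 0).mono fun x hx => hx.1)
    fun x _ => measurableSet_chainReach hm hs hQc _ _ _ _ _

end Measurability

section ErgodicLimit

variable {Ω : Type*} [MeasurableSpace Ω] {P : Measure Ω} {τ : ℤ → Ω → Ω}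

theorem IsErgodicGroup.iterate (hτ : IsErgodicGroup P τ) (m : ℕ) (ω : Ω) :
    (τ 1)^[m] ω = τ m ω := by
  induction m with
  | zero => simp [hτ.zero]
  | succ m ih =>
    rw [Function.iterate_succ_apply', ih, Nat.cast_succ, add_comm, hτ.add, Function.comp_apply]

/-- A set invariant under `τ 1` is invariant under every `τ k`, by induction in both directions, so
the ergodic theorems for a single map apply. -/
theorem IsErgodicGroup.ergodic_one (hτ : IsErgodicGroup P τ) (U : Set Ω) (hU : MeasurableSet U)
    (h : τ 1 ⁻¹' U = U) : P U = 1 ∨ P U = 0 := by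
  have hinv : ∀ k : ℤ, ∀ ω, τ k (τ (-k) ω) = ω := fun k ω => by
    have := congrFun (hτ.add k (-k)) ω
    rw [add_neg_cancel, hτ.zero] at this
    exact this.symm
  have hiff : ∀ ω, τ 1 ω ∈ U ↔ ω ∈ U := fun ω => by
    conv_rhs => rw [← h]
    rfl
  have hk : ∀ k : ℤ, ∀ ω, τ k ω ∈ U ↔ ω ∈ U := by
    intro k
    induction k using Int.induction_on with
    | zero => simp [hτ.zero]
    | succ i ih =>
      intro ω
      rw [add_comm, hτ.add, Function.comp_apply, hiff, ih]
    | pred i ih =>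
      intro ω
      rw [← hiff, ← Function.comp_apply (f := τ 1), ← hτ.add]
      have : (1 : ℤ) + (-i - 1) = -i := by ring
      rw [this, ih]
  refine hτ.ergodic U hU fun k => ?_
  ext ω
  constructor
  · rintro ⟨ω', hω', rfl⟩
    exact (hk k ω').2 hω'
  · exact fun hω => ⟨τ (-k) ω, (hk (-k) ω).2 hω, hinv k ω⟩

theorem IsAdmissibleVelocity.exists_isSpeed {a : E n → ℝ → Ω → ℝ}
    (ha : IsAdmissibleVelocity τ a) :
    ∃ α β : ℝ, ∀ ω, ∃ K, IsSpeed (fun y s => a y s ω) α β K := by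
  obtain ⟨α, β, hα, -, hb⟩ := ha.bounds
  refine ⟨α, β, fun ω => ?_⟩
  obtain ⟨K, hK⟩ := ha.lipschitz ω
  refine ⟨K, hα, fun x t => (hb x t ω).1, fun x t => (hb x t ω).2, K.2, fun x y t s => ?_⟩
  have h1 := hK.dist_le_mul (x, t) (y, s)
  rw [Real.dist_eq] at h1
  refine h1.trans (mul_le_mul_of_nonneg_left ?_ K.2)
  rw [Prod.dist_eq, dist_eq_norm, Real.dist_eq]
  exact max_le_add_of_nonneg (norm_nonneg _) (abs_nonneg _)

theorem IsAdmissibleVelocity.isPeriodic {a : E n → ℝ → Ω → ℝ} (hτ : IsErgodicGroup P τ)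
    (ha : IsAdmissibleVelocity τ a) (ω : Ω) : IsPeriodic fun y s => a y s ω := fun l x t => by
  have := ha.stationary x l t 0 ω
  simpa [hτ.zero] using this

theorem IsAdmissibleVelocity.reachSupport_shift {a : E n → ℝ → Ω → ℝ}
    (ha : IsAdmissibleVelocity τ a) (p : E n) (k : ℤ) (ω : Ω) (s t : ℝ) :
    reachSupport (fun y s => a y s (τ k ω)) p s t =
      reachSupport (fun y s => a y s ω) p (s + k) (t + k) := by
  have h1 : (fun y s => a y s (τ k ω)) = fun y s => a y (s + k) ω := by
    ext y s
    have := ha.stationary y 0 s k ω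
    have h0 : (intVec 0 : E n) = 0 := by
      ext i
      simp [intVec]
    rwa [h0, add_zero] at this
  unfold reachSupport
  rw [h1]
  congr 2
  ext x
  exact Reach.shift_iff (c := fun y s => a y s ω) (k : ℝ)

theorem IsAdmissibleVelocity.exists_ae_tendsto [IsProbabilityMeasure P] {a : E n → ℝ → Ω → ℝ}
    (hτ : IsErgodicGroup P τ) (ha : IsAdmissibleVelocity τ a) (p : E n) :
    ∃ h : ℝ, ∀ᵐ ω ∂P, Tendsto (fun N : ℕ => reachSupport (fun y s => a y s ω) p 0 N / N) atTop
      (𝓝 h) := by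
  obtain ⟨α, β, hs⟩ := ha.exists_isSpeed
  refine exists_ae_tendsto_of_almost_additive (hτ.measurePreserving 1) hτ.ergodic_one
    (f := fun N ω => reachSupport (fun y s => a y s ω) p 0 N) (B := ‖p‖ * β)
    (C := ‖p‖ * discrepancy n α β)
    (fun N => measurable_reachSupport ha.measurable hs p (Nat.cast_nonneg N)) (fun N ω => ?_)
    fun k N ω => ?_
  · obtain ⟨K, hc⟩ := hs ω
    have := abs_reachSupport_le hc p (Nat.cast_nonneg N)
    rwa [sub_zero, ← mul_assoc] at this
  · obtain ⟨K, hc⟩ := hs ω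
    have := abs_reachSupport_sub_le hc (ha.isPeriodic hτ ω) p (Nat.cast_nonneg k)
      (le_add_of_nonneg_right (Nat.cast_nonneg N) : (k : ℝ) ≤ k + N)
    simp only [hτ.iterate, ha.reachSupport_shift, Nat.cast_add]
    rw [zero_add, Int.cast_natCast, add_comm (N : ℝ)]
    exact this

end ErgodicLimit

end StochHom

/-! ### The shape theorem -/

namespace StochHom

variable {n : ℕ} {c : E n → ℝ → ℝ} {α β K : ℝ}

theorem eventually_const_le_mul (C : ℝ) {η : ℝ} (hη : 0 < η) :
    ∀ᶠ t : ℝ in atTop, C ≤ η * t := by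
  filter_upwards [eventually_ge_atTop (C / η)] with t ht
  rwa [div_le_iff₀' hη] at ht

/-- By almost additivity, rounding `t` down to an integer changes the support function by a bounded
amount. -/
theorem tendsto_reachSupport_div (hc : IsSpeed c α β K) (hper : IsPeriodic c) {p : E n} {l : ℝ}
    (h : Tendsto (fun N : ℕ => reachSupport c p 0 N / N) atTop (𝓝 l)) :
    Tendsto (fun t : ℝ => reachSupport c p 0 t / t) atTop (𝓝 l) := by
  have hβ := hc.beta_pos
  have h1 : Tendsto (fun t : ℝ => reachSupport c p 0 (⌊t⌋₊ : ℝ) / (⌊t⌋₊ : ℝ)) atTop (𝓝 l) :=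
    h.comp tendsto_nat_floor_atTop
  have h2 : Tendsto (fun t : ℝ => (⌊t⌋₊ : ℝ) / t) atTop (𝓝 1) := tendsto_nat_floor_div_atTop
  have h3 := h1.mul h2
  rw [mul_one] at h3
  set M := ‖p‖ * β + ‖p‖ * discrepancy n α β
  have h4 : Tendsto (fun t : ℝ => reachSupport c p 0 t / t -
      reachSupport c p 0 (⌊t⌋₊ : ℝ) / (⌊t⌋₊ : ℝ) * ((⌊t⌋₊ : ℝ) / t)) atTop (𝓝 0) := by
    refine squeeze_zero_norm' (a := fun t => M / t) ?_ (tendsto_const_nhds.div_atTop tendsto_id)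
    filter_upwards [eventually_ge_atTop 1] with t ht
    have ht0 : 0 < t := by linarith
    have hf0 : 0 < (⌊t⌋₊ : ℝ) := by exact_mod_cast Nat.floor_pos.2 ht
    have hfl := Nat.floor_le ht0.le
    have hfl2 := Nat.lt_floor_add_one t
    have e1 : reachSupport c p 0 t / t -
      reachSupport c p 0 (⌊t⌋₊ : ℝ) / (⌊t⌋₊ : ℝ) * ((⌊t⌋₊ : ℝ) / t) =
        (reachSupport c p 0 t - reachSupport c p 0 (⌊t⌋₊ : ℝ)) / t := by field_simp
    rw [e1, Real.norm_eq_abs, abs_div, abs_of_pos ht0]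
    gcongr
    have e2 := abs_le.1 (abs_reachSupport_sub_le hc hper p hf0.le hfl)
    have e3 := abs_le.1 (abs_reachSupport_le hc p hfl)
    have e4 : ‖p‖ * (β * (t - ⌊t⌋₊)) ≤ ‖p‖ * β := by
      gcongr
      nlinarith
    exact abs_le.2 ⟨by simp only [M]; linarith, by simp only [M]; linarith⟩
  have h5 := h4.add h3
  rw [zero_add] at h5
  exact h5.congr fun t => by ring

/-- A point whose linear functionals are almost dominated by those of a set is close to its closed
convex hull. -/
theorem exists_mem_closure_convexHull_near {A : Set (E n)} (hA : A.Nonempty) {q : E n} {r : ℝ}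
    (hr : 0 ≤ r)
    (h : ∀ p : E n, ‖p‖ = 1 → ∀ b, (∀ x ∈ A, inner ℝ p x ≤ b) → inner ℝ p q ≤ b + r) :
    ∃ z ∈ closure (convexHull ℝ A), ‖q - z‖ ≤ r := by
  have hconv : Convex ℝ (closure (convexHull ℝ A)) := (convex_convexHull ℝ A).closure
  obtain ⟨z, hz, hmin⟩ := exists_norm_eq_iInf_of_complete_convex
    (K := closure (convexHull ℝ A)) hA.convexHull.closure isClosed_closure.isComplete hconv q
  have hproj := (norm_eq_iInf_iff_real_inner_le_zero hconv hz).1 hmin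
  refine ⟨z, hz, ?_⟩
  rcases (norm_nonneg (q - z)).eq_or_lt with h0 | h0
  · rw [← h0]
    exact hr
  have h1 : ‖(‖q - z‖⁻¹ • (q - z))‖ = 1 := by
    rw [norm_smul, norm_inv, norm_norm, inv_mul_cancel₀ h0.ne']
  -- The test direction is the unit vector from the projection `z` to `q`; there `z` maximises the
  -- functional over the closed hull.
  have h2 := h _ h1 (inner ℝ (‖q - z‖⁻¹ • (q - z)) z) fun x hx => by
    have := hproj x (subset_closure (subset_convexHull ℝ A hx))
    rw [inner_sub_right] at this
    rw [real_inner_smul_left, real_inner_smul_left]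
    gcongr
    linarith
  have h3 : inner ℝ (‖q - z‖⁻¹ • (q - z)) q - inner ℝ (‖q - z‖⁻¹ • (q - z)) z = ‖q - z‖ := by
    rw [← inner_sub_right, real_inner_smul_left, real_inner_self_eq_norm_sq]
    field_simp
  linarith

/-- The closed convex set with prescribed bounds on the linear functionals in `Q`. -/
def wulffSet (Q : Set (E n)) (h : E n → ℝ) : Set (E n) := {q | ∀ p ∈ Q, inner ℝ p q ≤ h p}

theorem convex_wulffSet (Q : Set (E n)) (h : E n → ℝ) : Convex ℝ (wulffSet Q h) := by
  intro x hx y hy a b ha hb hab p hp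
  rw [inner_add_right, inner_smul_right, inner_smul_right]
  calc _ ≤ a * h p + b * h p := by
        gcongr
        · exact hx p hp
        · exact hy p hp
    _ = h p := by rw [← add_mul, hab, one_mul]

theorem isClosed_wulffSet (Q : Set (E n)) (h : E n → ℝ) : IsClosed (wulffSet Q h) := by
  have : wulffSet Q h = ⋂ p ∈ Q, {q | inner ℝ p q ≤ h p} := by
    ext
    simp [wulffSet]
  rw [this]
  exact isClosed_biInter fun p _ => isClosed_le (by fun_prop) continuous_const

section Shape

variable {Q : Set (E n)} {h : E n → ℝ} (hc : IsSpeed c α β K) (hper : IsPeriodic c)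
  (hlim : ∀ p ∈ Q, Tendsto (fun N : ℕ => reachSupport c p 0 N / N) atTop (𝓝 (h p)))
include hc hper hlim

/-- The limits satisfy `h p ≤ ‖p‖ * β`. By density `p · q ≤ ‖p‖ * β` for all `p`, in particular for
`p = q`. -/
theorem norm_le_of_mem_wulffSet (hQ : Dense Q) {q : E n} (hq : q ∈ wulffSet Q h) : ‖q‖ ≤ β := by
  have hβ := hc.beta_pos
  have h1 : ∀ p ∈ Q, inner ℝ p q ≤ ‖p‖ * β := fun p hp => by
    refine (hq p hp).trans (le_of_tendsto (tendsto_reachSupport_div hc hper (hlim p hp)) ?_)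
    filter_upwards [eventually_gt_atTop 0] with t ht
    have := (abs_le.1 (abs_reachSupport_le hc p ht.le)).2
    rw [div_le_iff₀ ht]
    rw [sub_zero] at this
    linarith
  have h2 : IsClosed {p : E n | inner ℝ p q ≤ ‖p‖ * β} :=
    isClosed_le (by fun_prop) (by fun_prop)
  have h3 : q ∈ {p : E n | inner ℝ p q ≤ ‖p‖ * β} := (h2.closure_subset_iff.2 h1) (hQ q)
  have h4 : ‖q‖ ^ 2 ≤ ‖q‖ * β := by
    rw [← real_inner_self_eq_norm_sq]
    exact h3
  rcases (norm_nonneg q).eq_or_lt with h0 | h0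
  · rw [← h0]
    exact hβ.le
  · rw [sq] at h4
    exact le_of_mul_le_mul_left h4 h0

/-- By compactness: reachable points that stay far from `t D` would have rescaled limits satisfying
every constraint in `Q`, that is, limits in `D`. -/
theorem eventually_reach_subset_wulffSet {η : ℝ} (hη : 0 < η) :
    ∀ᶠ t : ℝ in atTop, ∀ x, Reach c 0 0 x t → ∃ q ∈ wulffSet Q h, ‖x - t • q‖ ≤ η * t := by
  by_contra hcon
  rw [not_eventually, frequently_atTop] at hcon
  have h1 : ∀ k : ℕ, ∃ t : ℝ, (k : ℝ) + 1 ≤ t ∧ ∃ x, Reach c 0 0 x t ∧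
      ∀ q ∈ wulffSet Q h, η * t < ‖x - t • q‖ := fun k => by
    obtain ⟨t, ht, hx⟩ := hcon (k + 1)
    push Not at hx
    exact ⟨t, ht, hx⟩
  choose t ht x hx hfar using h1
  have ht0 : ∀ k, 0 < t k := fun k => lt_of_lt_of_le (by positivity) (ht k)
  have htop : Tendsto t atTop atTop :=
    tendsto_atTop_mono (fun k => (by linarith [ht k] : (k : ℝ) ≤ t k)) tendsto_natCast_atTop_atTop
  have hball : ∀ k, (t k)⁻¹ • x k ∈ Metric.closedBall (0 : E n) β := fun k => by
    have := (hx k).norm_sub_le hc (ht0 k).le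
    rw [sub_zero, sub_zero] at this
    rw [mem_closedBall_zero_iff, norm_smul, norm_inv, Real.norm_eq_abs, abs_of_pos (ht0 k),
      inv_mul_le_iff₀ (ht0 k)]
    linarith
  obtain ⟨y, -, φ, hφ, hy⟩ := (isCompact_closedBall (0 : E n) β).tendsto_subseq hball
  have hyD : y ∈ wulffSet Q h := fun p hp => by
    have e1 : Tendsto (fun k => inner ℝ p ((t (φ k))⁻¹ • x (φ k))) atTop (𝓝 (inner ℝ p y)) :=
      tendsto_const_nhds.inner hy
    have e2 : Tendsto (fun k => reachSupport c p 0 (t (φ k)) / t (φ k)) atTop (𝓝 (h p)) :=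
      (tendsto_reachSupport_div hc hper (hlim p hp)).comp (htop.comp hφ.tendsto_atTop)
    refine le_of_tendsto_of_tendsto' e1 e2 fun k => ?_
    rw [inner_smul_right, inv_mul_eq_div]
    have := ht0 (φ k)
    gcongr
    exact inner_le_reachSupport hc p this.le (hx _)
  have hnear : ∀ᶠ k in atTop, dist ((t (φ k))⁻¹ • x (φ k)) y < η :=
    hy.eventually (Metric.ball_mem_nhds y hη)
  obtain ⟨k, hk⟩ := hnear.exists
  have h2 := hfar (φ k) y hyD
  have h3 : x (φ k) - t (φ k) • y = t (φ k) • ((t (φ k))⁻¹ • x (φ k) - y) := by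
    rw [smul_sub, smul_inv_smul₀ (ht0 _).ne']
  rw [h3, norm_smul, Real.norm_eq_abs, abs_of_pos (ht0 _), mul_comm η] at h2
  rw [dist_eq_norm] at hk
  exact absurd (lt_of_mul_lt_mul_left h2 (ht0 _).le) (not_lt.2 hk.le)

theorem wulffSet_nonempty : (wulffSet Q h).Nonempty := by
  obtain ⟨t, ht, ht0⟩ := ((eventually_reach_subset_wulffSet hc hper hlim one_pos).and
    (eventually_ge_atTop 0)).exists
  obtain ⟨q, hq, -⟩ := ht 0 (Reach.const hc 0 ht0)
  exact ⟨q, hq⟩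

/-- The rates are known only for `p ∈ Q`. A finite net of the unit sphere taken from `Q` gives
uniformity in `p`, because both `q` and the rescaled reachable points have norm at most `β`. -/
theorem eventually_inner_le_reachSupport (hQ : Dense Q) {η : ℝ} (hη : 0 < η) :
    ∀ᶠ t : ℝ in atTop, ∀ q ∈ wulffSet Q h, ∀ p : E n, ‖p‖ = 1 → ∀ b,
      (∀ x, Reach c 0 0 x t → inner ℝ p x ≤ b) → inner ℝ p (t • q) ≤ b + η * t := by
  have hβ := hc.beta_pos
  set δ := η / (4 * β) with hδ
  have hδ0 : 0 < δ := by positivity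
  have hδβ : δ * β = η / 4 := by simp only [hδ]; field_simp
  obtain ⟨F, hFQ, hFfin, hF⟩ := (isCompact_sphere (0 : E n) 1).elim_finite_subcover_image
    (b := Q) (c := fun p => Metric.ball p δ) (fun p _ => Metric.isOpen_ball) fun p _ => by
      obtain ⟨p', hp', hd⟩ := hQ.exists_dist_lt p hδ0
      exact mem_biUnion hp' hd
  have hev : ∀ᶠ t : ℝ in atTop, ∀ p ∈ F, h p - η / 4 < reachSupport c p 0 t / t :=
    (eventually_all_finite hFfin).2 fun p hp =>
      (tendsto_reachSupport_div hc hper (hlim p (hFQ hp))).eventually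
        (lt_mem_nhds (sub_lt_self _ (by positivity)))
  filter_upwards [hev, eventually_gt_atTop 0] with t ht ht0 q hq p hp b hb
  obtain ⟨p', hp', hpp⟩ := mem_iUnion₂.1 (hF (by simpa using hp : p ∈ Metric.sphere (0 : E n) 1))
  rw [Metric.mem_ball, dist_eq_norm] at hpp
  have h1 := ht p' hp'
  rw [lt_div_iff₀ ht0] at h1
  obtain ⟨x, hx, hxp⟩ := exists_lt_inner_of_lt_reachSupport hc ht0.le h1
  have h2 := hb x hx
  have hxn := hx.norm_sub_le hc ht0.le
  rw [sub_zero, sub_zero] at hxn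
  have hqn := norm_le_of_mem_wulffSet hc hper hlim hQ hq
  have h3 : inner ℝ p' x - inner ℝ p x ≤ δ * (β * t) := by
    rw [← inner_sub_left]
    refine (real_inner_le_norm _ _).trans ?_
    rw [norm_sub_rev]
    gcongr
  have h4 : inner ℝ p q - inner ℝ p' q ≤ δ * β := by
    rw [← inner_sub_left]
    exact (real_inner_le_norm _ _).trans (by gcongr)
  have h5 := hq p' (hFQ hp')
  rw [inner_smul_right]
  have h6 : t * inner ℝ p q ≤ t * (h p' + δ * β) := by
    gcongr
    linarith
  have h7 : δ * (β * t) = η / 4 * t := by rw [← mul_assoc, hδβ]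
  rw [hδβ] at h6
  nlinarith

/-- Domination of linear functionals places `t • q` near the closed convex hull of the reachable
set, and asymptotic convexity brings it near the set itself. -/
theorem eventually_wulffSet_subset_reach (hQ : Dense Q) {η : ℝ} (hη : 0 < η) :
    ∀ᶠ t : ℝ in atTop, ∀ q ∈ wulffSet Q h, ∃ x, Reach c 0 0 x t ∧ ‖x - t • q‖ ≤ η * t := by
  have hη3 : 0 < η / 3 := by positivity
  filter_upwards [eventually_inner_le_reachSupport hc hper hlim hQ hη3,
    eventually_exists_reach_near_convexHull hc hper hη3, eventually_gt_atTop 0]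
    with t h1 h2 ht q hq
  obtain ⟨z, hz, hzn⟩ := exists_mem_closure_convexHull_near
    (A := {x | Reach c 0 0 x t}) ⟨0, Reach.const hc 0 ht.le⟩ (q := t • q) (r := η / 3 * t)
    (by positivity) (h1 q hq)
  obtain ⟨z', hz', hzz⟩ := Metric.mem_closure_iff.1 hz (η / 3 * t) (by positivity)
  obtain ⟨x, hx, hxn⟩ := h2 z' hz'
  refine ⟨x, hx, ?_⟩
  have h3 : x - t • q = (x - z') - (z - z') - (t • q - z) := by abel
  rw [dist_eq_norm] at hzz
  rw [h3]
  refine (norm_sub_le _ _).trans ?_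
  have := norm_sub_le (x - z') (z - z')
  linarith

/-- Shape theorem: the reachable displacements at time `t` are close to `t D`. -/
theorem eventually_reach_shape (hQ : Dense Q) {η : ℝ} (hη : 0 < η) :
    ∀ᶠ t : ℝ in atTop,
      (∀ y x, Reach c y 0 x t → ∃ q ∈ wulffSet Q h, ‖x - y - t • q‖ ≤ η * t) ∧
      (∀ y, ∀ q ∈ wulffSet Q h, ∃ x, Reach c y 0 x t ∧ ‖x - y - t • q‖ ≤ η * t) := by
  have hη2 : 0 < η / 2 := by positivity
  filter_upwards [eventually_reach_subset_wulffSet hc hper hlim hη2,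
    eventually_wulffSet_subset_reach hc hper hlim hQ hη2, eventually_ge_atTop 0,
    eventually_const_le_mul (discrepancy n α β) hη2] with t h1 h2 ht h3
  constructor
  · intro y x hx
    obtain ⟨x', hx', hn⟩ := hx.exists_of_start hc hper ht 0
    obtain ⟨q, hq, hqn⟩ := h1 x' hx'
    refine ⟨q, hq, ?_⟩
    have e : x - y - t • q = (x' - t • q) - (x' - 0 - (x - y)) := by
      rw [sub_zero]
      abel
    rw [e]
    refine (norm_sub_le _ _).trans ?_
    linarith
  · intro y q hq
    obtain ⟨x', hx', hxn⟩ := h2 q hq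
    obtain ⟨x, hx, hn⟩ := hx'.exists_of_start hc hper ht y
    refine ⟨x, hx, ?_⟩
    have e : x - y - t • q = (x' - t • q) + (x - y - (x' - 0)) := by
      rw [sub_zero]
      abel
    rw [e]
    refine (norm_add_le _ _).trans ?_
    linarith

/-- The shape theorem for prescribed end points. -/
theorem eventually_reach_shape_endpoint (hQ : Dense Q) {η : ℝ} (hη : 0 < η) :
    ∀ᶠ t : ℝ in atTop, ∀ x, ∀ q ∈ wulffSet Q h, ∃ y, Reach c y 0 x t ∧
      ‖x - y - t • q‖ ≤ η * t := by
  have hα := hc.pos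
  have hβ := hc.beta_pos
  have hη2 : 0 < η / 2 := by positivity
  set T := √(n : ℝ) / α with hT
  have hT0 : 0 ≤ T := by positivity
  have hlim' : Tendsto (fun t : ℝ => t - T) atTop atTop := tendsto_atTop_add_const_right _ _ tendsto_id
  filter_upwards [hlim'.eventually (eventually_reach_shape hc hper hlim hQ hη2),
    eventually_ge_atTop T, eventually_const_le_mul (√n + T * β) hη2] with t h1 ht h2 x q hq
  obtain ⟨e, he, hen⟩ := h1.2 0 q hq
  obtain ⟨l, hl⟩ := exists_intVec_near e x
  have hr := he.add_vec (fun x t => hper l x t)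
  -- A path from the origin runs for time `t - T` and is translated by an integer vector so as to
  -- end within `√n` of `x`; the remaining time `T` is enough to hit `x` exactly.
  refine ⟨0 + intVec l, hr.trans (by linarith) (by linarith) (Reach.of_norm_le hc (by linarith) ?_),
    ?_⟩
  · rw [norm_sub_rev, sub_sub_cancel, hT, mul_div_cancel₀ _ hα.ne']
    exact hl
  · have e1 : x - (0 + intVec l) - t • q = (e - 0 - (t - T) • q) - (e + intVec l - x) - T • q := by
      rw [sub_smul]
      abel
    have e2 : ‖T • q‖ ≤ T * β := by
      rw [norm_smul, Real.norm_eq_abs, abs_of_nonneg hT0]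
      have := norm_le_of_mem_wulffSet hc hper hlim hQ hq
      gcongr
    rw [e1]
    refine (norm_sub_le _ _).trans ?_
    have := norm_sub_le (e - 0 - (t - T) • q) (e + intVec l - x)
    have : η / 2 * (t - T) ≤ η / 2 * t := by gcongr; linarith
    linarith

theorem tendsto_hausdorffEDist_reachableSet (hQ : Dense Q) :
    Tendsto (fun t : ℝ => ⨆ x ∈ unitCell n, Metric.hausdorffEDist (t⁻¹ • reachableSet c t x)
      (wulffSet Q h)) atTop (𝓝 0) := by
  rw [ENNReal.tendsto_nhds_zero]
  intro ε hε
  obtain ⟨η, hη, hηε⟩ : ∃ η : ℝ, 0 < η ∧ ENNReal.ofReal η ≤ ε := by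
    rcases eq_or_ne ε ⊤ with rfl | hε'
    · exact ⟨1, one_pos, le_top⟩
    · exact ⟨ε.toReal, ENNReal.toReal_pos hε.ne' hε',
        (ENNReal.ofReal_toReal hε').le⟩
  have hη2 : 0 < η / 2 := by positivity
  filter_upwards [eventually_reach_shape hc hper hlim hQ hη2, eventually_gt_atTop 0,
    eventually_const_le_mul (√n) hη2] with t ⟨h1, h2⟩ ht h3
  refine iSup₂_le fun x hx => le_trans ?_ hηε
  -- The shape theorem concerns displacements, whereas here the points themselves are rescaled; on
  -- the unit cell the difference `x / t` is uniformly negligible.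
  have hxn : ‖x‖ ≤ √n := by
    rw [EuclideanSpace.norm_eq]
    refine Real.sqrt_le_sqrt ?_
    calc ∑ i, ‖x i‖ ^ 2 ≤ ∑ _i : Fin n, (1 : ℝ) := Finset.sum_le_sum fun i _ => by
          rw [Real.norm_eq_abs, abs_of_nonneg (hx i).1]
          exact pow_le_one₀ (hx i).1 (hx i).2
      _ = n := by simp
  have hscale : ∀ y q : E n, ‖y - x - t • q‖ ≤ η / 2 * t →
      edist (t⁻¹ • y) q ≤ ENNReal.ofReal η := fun y q hyq => by
    rw [edist_dist, dist_eq_norm]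
    refine ENNReal.ofReal_le_ofReal ?_
    have e1 : t⁻¹ • y - q = t⁻¹ • ((y - x - t • q) + x) := by
      rw [sub_right_comm, sub_add_cancel, smul_sub, inv_smul_smul₀ ht.ne']
    rw [e1, norm_smul, norm_inv, Real.norm_eq_abs, abs_of_pos ht, inv_mul_le_iff₀ ht]
    refine (norm_add_le _ _).trans ?_
    linarith
  refine Metric.hausdorffEDist_le_of_mem_edist ?_ ?_
  · rintro - ⟨y, hy, rfl⟩
    rw [mem_reachableSet_iff hc ht.le] at hy
    obtain ⟨q, hq, hyq⟩ := h1 x y hy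
    exact ⟨q, hq, hscale y q hyq⟩
  · intro q hq
    obtain ⟨y, hy, hyq⟩ := h2 x q hq
    refine ⟨t⁻¹ • y, smul_mem_smul_set ((mem_reachableSet_iff hc ht.le).2 hy), ?_⟩
    rw [edist_comm]
    exact hscale y q hyq

end Shape

end StochHom

/-! ### Scaling and convergence of the solutions -/

namespace StochHom

variable {n : ℕ} {c : E n → ℝ → ℝ} {α β K : ℝ}

theorem Reach.scale {ε : ℝ} (hε : 0 < ε) {y x : E n} {s t : ℝ} (h : Reach c y s x t) :
    Reach (fun x t => c (ε⁻¹ • x) (t / ε)) (ε • y) (ε * s) (ε • x) (ε * t) := by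
  obtain ⟨γ, hγ, rfl, rfl⟩ := h
  refine ⟨fun r => ε • γ (r / ε), fun r₁ r₂ a1 a2 a3 M hM => ?_, ?_, ?_⟩
  · have h1 := hγ (r₁ / ε) (r₂ / ε) ((le_div_iff₀' hε).2 a1) (by gcongr) ((div_le_iff₀' hε).2 a3) M
      fun r hr => by
        have := hM (ε * r) ⟨(div_le_iff₀' hε).1 hr.1, (le_div_iff₀' hε).1 hr.2⟩
        simpa only [mul_div_cancel_left₀ _ hε.ne', inv_smul_smul₀ hε.ne'] using this
    rw [← smul_sub, norm_smul, Real.norm_eq_abs, abs_of_pos hε]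
    calc _ ≤ ε * (M * (r₂ / ε - r₁ / ε)) := by gcongr
      _ = _ := by field_simp
  · simp only [mul_div_cancel_left₀ _ hε.ne']
  · simp only [mul_div_cancel_left₀ _ hε.ne']

theorem Reach.scale_iff {ε : ℝ} (hε : 0 < ε) {y x : E n} {s t : ℝ} :
    Reach (fun x t => c (ε⁻¹ • x) (t / ε)) y s x t ↔
      Reach c (ε⁻¹ • y) (s / ε) (ε⁻¹ • x) (t / ε) := by
  constructor
  · intro h
    have := h.scale (inv_pos.2 hε)
    simpa only [inv_inv, div_inv_eq_mul, inv_smul_smul₀ hε.ne', mul_div_cancel_right₀ _ hε.ne',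
      inv_mul_eq_div] using this
  · intro h
    have := h.scale hε
    simpa only [smul_inv_smul₀ hε.ne', mul_div_cancel₀ _ hε.ne'] using this

theorem IsSpeed.scale (hc : IsSpeed c α β K) {ε : ℝ} (hε : 0 < ε) :
    IsSpeed (fun x t => c (ε⁻¹ • x) (t / ε)) α β (K / ε) where
  pos := hc.pos
  lower _ _ := hc.lower _ _
  upper _ _ := hc.upper _ _
  nonneg := div_nonneg hc.nonneg hε.le
  lip x y t s := by
    refine (hc.lip _ _ _ _).trans_eq ?_
    rw [← smul_sub, norm_smul, norm_inv, Real.norm_eq_abs, abs_of_pos hε, ← sub_div, abs_div,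
      abs_of_pos hε]
    field_simp

variable {Q : Set (E n)} {h : E n → ℝ}

/-- If `t / ε` is large, the shape theorem applies at that time, uniformly in the end point. If `t ≤
T₀ * ε`, both displacements are at most `β * T₀ * ε` and there is nothing to prove for small `ε`. -/
theorem eventually_scaled_reach_near (hc : IsSpeed c α β K) (hper : IsPeriodic c) (hQ : Dense Q)
    (hlim : ∀ p ∈ Q, Tendsto (fun N : ℕ => reachSupport c p 0 N / N) atTop (𝓝 (h p)))
    {T : ℝ} (hT : 0 ≤ T) {ζ : ℝ} (hζ : 0 < ζ) :
    ∀ᶠ ε in 𝓝[>] (0 : ℝ), ∀ t, 0 ≤ t → t ≤ T → ∀ x : E n,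
      (∀ y, Reach (fun x t => c (ε⁻¹ • x) (t / ε)) y 0 x t →
        ∃ q ∈ wulffSet Q h, ‖x - y - t • q‖ < ζ) ∧
      ∀ q ∈ wulffSet Q h, ∃ y, Reach (fun x t => c (ε⁻¹ • x) (t / ε)) y 0 x t ∧
        ‖x - y - t • q‖ < ζ := by
  have hβ := hc.beta_pos
  set η := ζ / (T + 1) with hη
  have hη0 : 0 < η := by positivity
  have hηT : η * T < ζ := by
    rw [hη, div_mul_eq_mul_div, div_lt_iff₀ (by positivity)]
    linarith
  obtain ⟨T₀, hT₀⟩ := eventually_atTop.1 ((eventually_reach_shape hc hper hlim hQ hη0).and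
    (eventually_reach_shape_endpoint hc hper hlim hQ hη0))
  have hpos : Ioi (0 : ℝ) ∈ 𝓝[>] (0 : ℝ) := self_mem_nhdsWithin
  filter_upwards [hpos, eventually_nhdsGT_zero_mul_lt (2 * β * T₀) hζ] with ε hε hεT t ht htT x
  have hε : 0 < ε := hε
  have hcε := hc.scale hε
  rcases le_total T₀ (t / ε) with hle | hle
  · obtain ⟨h1, h2⟩ := hT₀ _ hle
    have hscale : ∀ (y q : E n), ‖ε⁻¹ • x - ε⁻¹ • y - (t / ε) • q‖ ≤ η * (t / ε) →
        ‖x - y - t • q‖ < ζ := fun y q hyq => by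
      have e1 : ε⁻¹ • x - ε⁻¹ • y - (t / ε) • q = ε⁻¹ • (x - y - t • q) := by
        rw [smul_sub, smul_sub, smul_smul, inv_mul_eq_div]
      rw [e1, norm_smul, norm_inv, Real.norm_eq_abs, abs_of_pos hε, inv_mul_le_iff₀ hε] at hyq
      have e2 : ε * (η * (t / ε)) = η * t := by field_simp
      rw [e2] at hyq
      have : η * t ≤ η * T := by gcongr
      linarith
    constructor
    · intro y hy
      rw [Reach.scale_iff hε, zero_div] at hy
      obtain ⟨q, hq, hn⟩ := h1.1 _ _ hy
      exact ⟨q, hq, hscale y q hn⟩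
    · intro q hq
      obtain ⟨y, hy, hn⟩ := h2 (ε⁻¹ • x) q hq
      refine ⟨ε • y, ?_, hscale _ _ ?_⟩
      · rwa [Reach.scale_iff hε, zero_div, inv_smul_smul₀ hε.ne']
      · rwa [inv_smul_smul₀ hε.ne']
  · have hsmall : ∀ y, Reach (fun x t => c (ε⁻¹ • x) (t / ε)) y 0 x t → ∀ q ∈ wulffSet Q h,
        ‖x - y - t • q‖ < ζ := fun y hy q hq => by
      have e1 := hy.norm_sub_le hcε ht
      have e2 := norm_le_of_mem_wulffSet hc hper hlim hQ hq
      have e3 : ‖t • q‖ ≤ t * β := by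
        rw [norm_smul, Real.norm_eq_abs, abs_of_nonneg ht]
        gcongr
      rw [div_le_iff₀ hε] at hle
      have e4 : β * t ≤ β * (T₀ * ε) := by gcongr
      have := norm_sub_le (x - y) (t • q)
      linarith
    constructor
    · intro y hy
      obtain ⟨q, hq⟩ := wulffSet_nonempty hc hper hlim
      exact ⟨q, hq, hsmall y hy q hq⟩
    · exact fun q hq => ⟨x, Reach.const hcε x ht, hsmall x (Reach.const hcε x ht) q hq⟩

/-- Both solutions are infima of `u₀` over sets of starting points that are `ζ`-close, with `ζ`
taken from the uniform continuity of `u₀`. The estimate is uniform in `x` and in bounded times. -/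
theorem tendstoLocallyUniformlyOn_hopfLax (hc : IsSpeed c α β K) (hper : IsPeriodic c)
    (hQ : Dense Q)
    (hlim : ∀ p ∈ Q, Tendsto (fun N : ℕ => reachSupport c p 0 N / N) atTop (𝓝 (h p)))
    {u₀ : E n → ℝ} (hu₀ : UniformContinuous u₀) {u : ℝ → E n × ℝ → ℝ}
    (hu : ∀ ε, 0 < ε → EqOn (u ε) (valueFunction (Reach fun x t => c (ε⁻¹ • x) (t / ε)) u₀)
      (univ ×ˢ Ici (0 : ℝ))) :
    TendstoLocallyUniformlyOn u (hopfLax (wulffSet Q h) u₀) (𝓝[>] 0) (univ ×ˢ Ici (0 : ℝ)) := by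
  rw [Metric.tendstoLocallyUniformlyOn_iff]
  rintro κ hκ ⟨x₀, t₀⟩ ⟨-, ht₀⟩
  have ht₀ : 0 ≤ t₀ := ht₀
  obtain ⟨ζ, hζ, huc⟩ := Metric.uniformContinuous_iff.1 hu₀ (κ / 2) (by positivity)
  refine ⟨(univ ×ˢ Ici (0 : ℝ)) ∩ {z | z.2 < t₀ + 1}, inter_mem self_mem_nhdsWithin
    (mem_nhdsWithin_of_mem_nhds ((isOpen_lt continuous_snd continuous_const).mem_nhds
      (by simp))), ?_⟩
  have hpos : Ioi (0 : ℝ) ∈ 𝓝[>] (0 : ℝ) := self_mem_nhdsWithin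
  filter_upwards [hpos, eventually_scaled_reach_near hc hper hQ hlim (T := t₀ + 1) (by linarith) hζ]
    with ε hε hnear
  have hε : 0 < ε := hε
  have hcε := hc.scale hε
  rintro ⟨x, t⟩ ⟨hxt, htT⟩
  have ht : 0 ≤ t := hxt.2
  have htT : t < t₀ + 1 := htT
  obtain ⟨h1, h2⟩ := hnear t ht htT.le x
  rw [hu ε hε hxt, hopfLax_eq_valueFunction, Real.dist_eq, abs_sub_lt_iff]
  have hspeed : ∀ {y x : E n} {s t : ℝ}, 0 ≤ s → s ≤ t →
      (∃ q ∈ wulffSet Q h, x = y + (t - s) • q) → ‖x - y‖ ≤ β * (t - s) := by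
    rintro y x s t hs hst ⟨q, hq, rfl⟩
    have := norm_le_of_mem_wulffSet hc hper hlim hQ hq
    have := sub_nonneg.2 hst
    rw [add_sub_cancel_left, norm_smul, Real.norm_eq_abs, abs_of_nonneg this, mul_comm]
    gcongr
  constructor
  · obtain ⟨y, hy, hlt⟩ := exists_lt_of_valueFunction_lt (u₀ := u₀)
      (Rel := Reach fun x t => c (ε⁻¹ • x) (t / ε)) ⟨x, Reach.const hcε x ht⟩
      (lt_add_of_pos_right _ (half_pos hκ))
    obtain ⟨q, hq, hn⟩ := h1 y hy
    have h3 := valueFunction_le (Rel := fun y s x t => ∃ q ∈ wulffSet Q h, x = y + (t - s) • q)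
      (B := β) hspeed hu₀.continuous ht (y := x - t • q) (x := x) ⟨q, hq, by simp⟩
    have h4 := huc (a := x - t • q) (b := y) (by rwa [dist_eq_norm, sub_right_comm])
    rw [Real.dist_eq, abs_sub_lt_iff] at h4
    linarith
  · obtain ⟨q₀, hq₀⟩ := wulffSet_nonempty hc hper hlim
    obtain ⟨y, ⟨q, hq, hy⟩, hlt⟩ := exists_lt_of_valueFunction_lt (u₀ := u₀)
      (Rel := fun y s x t => ∃ q ∈ wulffSet Q h, x = y + (t - s) • q) (x := x) (t := t)
      ⟨x - t • q₀, q₀, hq₀, by simp⟩ (lt_add_of_pos_right _ (half_pos hκ))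
    rw [sub_zero] at hy
    obtain ⟨y', hy', hn⟩ := h2 q hq
    have h3 := valueFunction_le (fun _ h2 h => h.norm_sub_le hcε h2) hu₀.continuous ht hy'
    have h4 := huc (a := y) (b := y') (by
      rw [dist_eq_norm]
      have : y - y' = x - y' - t • q := by rw [hy]; abel
      rwa [this])
    rw [Real.dist_eq, abs_sub_lt_iff] at h4
    linarith

end StochHom

/-! ### Conclusion -/

theorem mainTheorem2 {n : ℕ} {Ω : Type*} [MeasurableSpace Ω] (P : Measure Ω)
    [IsProbabilityMeasure P] (τ : ℤ → Ω → Ω) (hτ : StochHom.IsErgodicGroup P τ)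
    (a : StochHom.E n → ℝ → Ω → ℝ) (ha : StochHom.IsAdmissibleVelocity τ a) :
    ∃ (D : Set (StochHom.E n)) (Ω' : Set Ω),
      IsCompact D ∧ Convex ℝ D ∧ D.Nonempty ∧ MeasurableSet Ω' ∧ P Ω' = 1 ∧
      ∀ ω ∈ Ω',
        -- `D` is the large time average of the reachable sets
        Tendsto (fun t : ℝ => ⨆ x ∈ StochHom.unitCell n, Metric.hausdorffEDist
            (t⁻¹ • StochHom.reachableSet (fun y s => a y s ω) t x) D) atTop (𝓝 0) ∧
        -- homogenization
        ∀ u₀ : StochHom.E n → ℝ, UniformContinuous u₀ →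
          (∀ ε : ℝ, 0 < ε → ∃ u : StochHom.E n × ℝ → ℝ,
            StochHom.IsUniqueViscositySolution
              (StochHom.oscHamiltonian (fun y s => a y s ω) ε) u₀ u) ∧
          StochHom.IsUniqueViscositySolution
            (fun _ _ p => StochHom.effHamiltonian D p) u₀ (StochHom.hopfLax D u₀) ∧
          ∀ u : ℝ → StochHom.E n × ℝ → ℝ,
            (∀ ε : ℝ, 0 < ε → StochHom.IsViscositySolution
              (StochHom.oscHamiltonian (fun y s => a y s ω) ε) u₀ (u ε)) →
            TendstoLocallyUniformlyOn u (StochHom.hopfLax D u₀) (𝓝[>] 0)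
              (univ ×ˢ Ici (0 : ℝ)) := by
  obtain ⟨α, β, hs⟩ := ha.exists_isSpeed
  obtain ⟨Q, hQc, hQ⟩ := TopologicalSpace.exists_countable_dense (StochHom.E n)
  -- The rate exists for every `p`, but each `p` has its own null set. Restricting to the countable
  -- set `Q` leaves one exceptional null set.
  choose h hh using fun p : StochHom.E n => ha.exists_ae_tendsto hτ p
  have hae : ∀ᵐ ω ∂P, ∀ p ∈ Q, Tendsto
      (fun N : ℕ => StochHom.reachSupport (fun y s => a y s ω) p 0 N / N) atTop (𝓝 (h p)) :=
    (ae_ball_iff hQc).2 fun p _ => hh p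
  obtain ⟨N, hN, hNm, hN0⟩ := exists_measurable_superset_of_null (ae_iff.1 hae)
  have hlim : ∀ ω ∈ Nᶜ, ∀ p ∈ Q, Tendsto
      (fun N : ℕ => StochHom.reachSupport (fun y s => a y s ω) p 0 N / N) atTop (𝓝 (h p)) :=
    fun ω hω => by_contra fun hcon => hω (hN hcon)
  -- The set `D` is deterministic, so one good `ω₀` shows that it is bounded and nonempty.
  obtain ⟨ω₀, hω₀⟩ := hae.exists
  obtain ⟨K₀, hc₀⟩ := hs ω₀
  have hper := ha.isPeriodic hτ
  have hD : IsCompact (StochHom.wulffSet Q h) :=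
    (isCompact_closedBall 0 β).of_isClosed_subset (StochHom.isClosed_wulffSet Q h) fun q hq =>
      mem_closedBall_zero_iff.2 (StochHom.norm_le_of_mem_wulffSet hc₀ (hper ω₀) hω₀ hQ hq)
  have hDconv := StochHom.convex_wulffSet Q h
  have hDne := StochHom.wulffSet_nonempty hc₀ (hper ω₀) hω₀
  refine ⟨StochHom.wulffSet Q h, Nᶜ, hD, hDconv, hDne, hNm.compl,
    (prob_compl_eq_one_iff hNm).2 hN0, fun ω hω => ?_⟩
  obtain ⟨K, hc⟩ := hs ω
  refine ⟨StochHom.tendsto_hausdorffEDist_reachableSet hc (hper ω) (hlim ω hω) hQ,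
    fun u₀ hu₀ => ⟨fun ε hε => ?_, ?_, fun u hu => ?_⟩⟩
  · exact ⟨_, StochHom.isUniqueViscositySolution_front (hc.scale hε) hu₀⟩
  · exact StochHom.isUniqueViscositySolution_hopfLax hD hDconv hDne hu₀
  · exact StochHom.tendstoLocallyUniformlyOn_hopfLax hc (hper ω) hQ (hlim ω hω) hu₀
      fun ε hε => (StochHom.isUniqueViscositySolution_front (hc.scale hε) hu₀).2 _ (hu ε hε)
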